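/- Let $f(z)=-2z^3+3z^2$, let $f^n$ denote its $n$-th iterate, and let $t$ be transcendental over $\mathbb{Q}$ (an element of an algebraically closed field $\Omega$ of characteristic zero, in which $\bar{\mathbb{Q}}$ and all preimages of $t$ are taken). Let $T_n$ be the regular ternary rooted tree with $n$ levels above the root. For $n\ge 2$, let $\mathrm{sgn}_2\colon \mathrm{Aut}(T_n)\to\{\pm1\}$ be the sign of the induced permutation of the nine vertices of level $2$. Define $E_1=\mathrm{Aut}(T_1)\cong S_3$ and $$E_n=\bigl(E_{n-1}\wr \mathrm{Aut}(T_1)\bigr)\cap\ker(\mathrm{sgn}_2)\subseteq \mathrm{Aut}(T_n)\qquad(n\ge2),$$ where $\mathrm{Aut}(T_n)$ is identified with $\mathrm{Aut}(T_{n-1})\wr\mathrm{Aut}(T_1)$ via a fixed labelling of $T_n$, which identifies each of the three subtrees above the vertices of level $1$ with $T_{n-1}$. For a field $K\ni t$, the group $\mathrm{Gal}(f^n(z)-t/K)$ acts on the tree with vertex set $\bigsqcup_{0\le i\le n}f^{-i}(t)$, in which a vertex $z$ of level $i\ge 1$ has parent $f(z)$. Below, $\cong$ means isomorphism of groups acting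 on rooted trees: an isomorphism of groups together with a compatible isomorphism of this tree with $T_n$. Then: 1. For every $n\ge1$, $\mathrm{Gal}\bigl(f^n(z)-t/\bar{\mathbb{Q}}(t)\bigr)\cong E_n$. 2. For every number field $L\subseteq\Omega$ and every $n\ge1$, $\mathrm{Gal}\bigl(f^n(z)-t/L(t)\bigr)\cong E_n$. 3. The geometric and the arithmetic monodromy groups of $f$ coincide: restriction of automorphisms is an isomorphism of profinite groups $$\varprojlim_n \mathrm{Gal}\bigl(f^n(z)-t/\bar{\mathbb{Q}}(t)\bigr)\;\longrightarrow\;\varprojlim_n \mathrm{Gal}\bigl(f^n(z)-t/\mathbb{Q}(t)\bigr).$$ -/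

import Mathlib

open Polynomial IntermediateField

noncomputable section

namespace Arboreal

/-! ### Rooted trees and their automorphisms -/

/-- A rooted tree is given by its set of vertices `V` and its parent map `V → V`, the root being
the vertex that is its own parent. Its automorphisms are the permutations of the vertices that
commute with the parent map. -/
def treeAut {V : Type*} (parent : V → V) : Subgroup (Equiv.Perm V) where
  carrier := {σ | ∀ v, σ (parent v) = parent (σ v)}
  one_mem' := fun _ => rfl
  mul_mem' := by
    intro σ τ hσ hτ v
    change σ (τ (parent v)) = parent (σ (τ v))
    rw [hτ v, hσ (τ v)]
  inv_mem' := by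
    intro σ hσ v
    rw [Equiv.Perm.inv_eq_iff_eq, hσ (σ⁻¹ v)]
    simp

/-- The vertices of the regular ternary rooted tree `T_n` with `n` levels: a vertex of level `i` is
labelled by a word `[ℓ₁, …, ℓᵢ]` of length `i ≤ n`; the root is the empty word. -/
abbrev Vertex (n : ℕ) : Type := {v : List (Fin 3) // v.length ≤ n}

instance (n : ℕ) : Finite (Vertex n) := (List.finite_length_le (Fin 3) n).to_subtype

namespace Vertex

/-- The level of a vertex of `T_n`. -/
def level {n : ℕ} (v : Vertex n) : ℕ := v.1.length

/-- The parent of `[ℓ₁, …, ℓᵢ]` is `[ℓ₁, …, ℓᵢ₋₁]`; the parent of the root is the root. -/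
def parent {n : ℕ} (v : Vertex n) : Vertex n :=
  ⟨v.1.dropLast, by have := v.2; rw [List.length_dropLast]; omega⟩

/-- The copy of the vertex `w` of `T_n` in the subtree of `T_{n+1}` that lies above the vertex
`[i]` of level one. -/
def above {n : ℕ} (i : Fin 3) (w : Vertex n) : Vertex (n + 1) :=
  ⟨i :: w.1, by simpa using w.2⟩

end Vertex

/-- The automorphism group of the rooted tree `T_n`. -/
abbrev AutT (n : ℕ) : Subgroup (Equiv.Perm (Vertex n)) := treeAut (Vertex.parent (n := n))

theorem level_iterate_parent {n : ℕ} (k : ℕ) (v : Vertex n) :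
    (Vertex.parent^[k] v).level = v.level - k := by
  induction k with
  | zero => simp
  | succ k ih =>
    rw [Function.iterate_succ_apply']
    simp only [Vertex.level, Vertex.parent, List.length_dropLast] at ih ⊢
    omega

theorem parent_eq_self_iff {n : ℕ} (v : Vertex n) : v.parent = v ↔ v.level = 0 := by
  constructor
  · intro h
    have := congrArg Vertex.level h
    simp only [Vertex.level, Vertex.parent, List.length_dropLast] at this ⊢
    omega
  · intro h
    have h1 : v.1 = [] := List.length_eq_zero_iff.mp h
    exact Subtype.ext (by simp [Vertex.parent, h1])

/-- Tree automorphisms preserve the level. -/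
theorem level_apply {n : ℕ} (σ : AutT n) (v : Vertex n) : (σ.1 v).level = v.level := by
  have hit : ∀ k : ℕ, Vertex.parent^[k] (σ.1 v) = σ.1 (Vertex.parent^[k] v) := by
    intro k
    induction k with
    | zero => rfl
    | succ k ih =>
      rw [Function.iterate_succ_apply', Function.iterate_succ_apply', ih]
      exact (σ.2 _).symm
  have hroot : ∀ w : Vertex n, (σ.1 w).level = 0 ↔ w.level = 0 := by
    intro w
    rw [← parent_eq_self_iff, ← parent_eq_self_iff, ← σ.2 w]
    exact σ.1.injective.eq_iff
  have key : ∀ k : ℕ, (σ.1 v).level - k = 0 ↔ v.level - k = 0 := by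
    intro k
    rw [← level_iterate_parent, ← level_iterate_parent, hit, hroot]
  have h1 := key v.level
  have h2 := key (σ.1 v).level
  omega

instance (n m : ℕ) : Fintype {v : Vertex n // v.level = m} := Fintype.ofFinite _

/-- `sgn_m`: the sign of the permutation of the vertices of level `m` that is induced by an
automorphism of `T_n`. -/
def sgn (n m : ℕ) : AutT n →* ℤˣ where
  toFun σ := Equiv.Perm.sign
    (σ.1.subtypePerm (p := fun v => v.level = m) (fun v => by rw [level_apply]))
  map_one' := by
    rw [← map_one (Equiv.Perm.sign (α := {v : Vertex n // v.level = m}))]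
    rfl
  map_mul' := by
    intro σ τ
    rw [← map_mul]
    rfl

/-- For `H ≤ Aut(T_n)` the wreath product `H ≀ Aut(T_1)` as a subgroup of `Aut(T_{n+1})`: it
consists of the automorphisms `((a₁, a₂, a₃), b)` with `aᵢ ∈ H`, which act by `aᵢ` on the copy of
`T_n` above the `i`-th vertex of level one and permute these three copies by `b`. -/
def wreath {n : ℕ} (H : Subgroup (AutT n)) : Subgroup (AutT (n + 1)) where
  carrier := {σ | ∃ (a : Fin 3 → AutT n) (b : Equiv.Perm (Fin 3)), (∀ i, a i ∈ H) ∧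
    ∀ (i : Fin 3) (w : Vertex n), σ.1 (w.above i) = ((a i).1 w).above (b i)}
  one_mem' := ⟨1, 1, fun _ => H.one_mem, fun _ _ => rfl⟩
  mul_mem' := by
    rintro σ τ ⟨a, b, ha, hσ⟩ ⟨a', b', ha', hτ⟩
    refine ⟨fun i => a (b' i) * a' i, b * b', fun i => H.mul_mem (ha _) (ha' _), fun i w => ?_⟩
    simp only [Subgroup.coe_mul, Equiv.Perm.mul_apply]
    rw [hτ, hσ]
  inv_mem' := by
    rintro σ ⟨a, b, ha, hσ⟩
    refine ⟨fun i => (a (b⁻¹ i))⁻¹, b⁻¹, fun i => H.inv_mem (ha _), fun i w => ?_⟩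
    simp only [Subgroup.coe_inv]
    rw [Equiv.Perm.inv_eq_iff_eq, hσ]
    simp

/-- The groups `E_n`: `E_1 = Aut(T_1)` and `E_n = (E_{n-1} ≀ Aut(T_1)) ∩ ker(sgn_2)` for `n ≥ 2`.
(`E_0` is the trivial group `Aut(T_0)`.) -/
def E : (n : ℕ) → Subgroup (AutT n)
  | 0 => ⊤
  | 1 => ⊤
  | n + 2 => wreath (E (n + 1)) ⊓ (sgn (n + 2) 2).ker

/-! ### The polynomial, its preimage trees and its arboreal Galois groups -/

/-- The cubic polynomial `f(z) = -2z³ + 3z²`. -/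
def f (R : Type*) [CommRing R] : R[X] := -2 * X ^ 3 + 3 * X ^ 2

/-- The polynomial `fⁿ(z) - t`, where `fⁿ` is the `n`-th iterate of `f`. -/
def arborealPoly {K : Type*} [Field K] (t : K) (n : ℕ) : K[X] := (f K).comp^[n] X - C t

theorem map_f {R S : Type*} [CommRing R] [CommRing S] (φ : R →+* S) :
    (f R).map φ = f S := by
  simp [f]

section Tree

variable {K : Type*} [Field K] (M : Type*) [Field M] [Algebra K M] (t : K) (n : ℕ)

/-- The vertices of the preimage tree of height `n` with root `t` in an extension `M` of `K`: the
disjoint union over `i ≤ n` of the sets of `z ∈ M` with `fⁱ(z) = t`. -/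
abbrev PreimageVertex : Type _ :=
  {p : ℕ × M // p.1 ≤ n ∧ (fun z => (f M).eval z)^[p.1] p.2 = algebraMap K M t}

variable {M t n}

/-- The parent of a vertex `z` of level `i + 1` is the vertex `f(z)` of level `i`; the parent of
the root is the root. -/
def PreimageVertex.parent : PreimageVertex M t n → PreimageVertex M t n
  | ⟨(0, z), h⟩ => ⟨(0, z), h⟩
  | ⟨(i + 1, z), h⟩ => ⟨(i, (f M).eval z), (Nat.le_succ i).trans h.1, h.2⟩

theorem map_iterate_f (σ : Gal(M/K)) (i : ℕ) (z : M) :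
    (fun z => (f M).eval z)^[i] (σ z) = σ ((fun z => (f M).eval z)^[i] z) := by
  induction i generalizing z with
  | zero => rfl
  | succ i ih =>
    rw [Function.iterate_succ_apply, Function.iterate_succ_apply, ← ih]
    congr 1
    change (f M).eval ((σ : M →+* M) z) = (σ : M →+* M) ((f M).eval z)
    rw [← eval_map_apply, map_f]

/-- The action of the Galois group on the preimage tree. -/
def galAct (σ : Gal(M/K)) (p : PreimageVertex M t n) : PreimageVertex M t n :=
  ⟨(p.1.1, σ p.1.2), p.2.1, by
    simp only [map_iterate_f]
    rw [p.2.2, AlgEquiv.commutes]⟩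

end Tree

/-- The Galois group of `M/K`, acting on the preimage tree of height `n` with root `t`, is
isomorphic to `E_n`, acting on `T_n`: there are an isomorphism `e` of rooted trees from `T_n` to
the preimage tree and an isomorphism `φ` of groups that are compatible with the actions. -/
def GalIsoE {K : Type*} [Field K] (M : Type*) [Field M] [Algebra K M] (t : K) (n : ℕ) : Prop :=
  ∃ (e : Vertex n ≃ PreimageVertex M t n) (φ : Gal(M/K) ≃* E n),
    (∀ v, e v.parent = (e v).parent) ∧
    ∀ (σ : Gal(M/K)) (v : Vertex n), e ((φ σ).1.1 v) = galAct σ (e v)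

section Fields

variable {K : Type*} [Field K] (Ω : Type*) [Field Ω] [Algebra K Ω]

/-- The splitting field `K(f⁻ⁿ(t))` of `fⁿ(z) - t` over `K` inside an algebraically closed
extension `Ω` of `K`. Its Galois group over `K` is `Gal(fⁿ(z) - t / K)`. -/
abbrev splitField (t : K) (n : ℕ) : IntermediateField K Ω :=
  IntermediateField.adjoin K ((arborealPoly t n).rootSet Ω)

variable {Ω}

theorem aeval_iterate (n : ℕ) (z : Ω) :
    aeval z ((f K).comp^[n] X) = (fun z => (f Ω).eval z)^[n] z := by
  induction n with
  | zero => simp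
  | succ n ih =>
    rw [Function.iterate_succ_apply', Function.iterate_succ_apply', aeval_comp, ih,
      aeval_def, ← eval_map, map_f]

variable [CharZero Ω]

theorem natDegree_f : (f Ω).natDegree = 3 := by
  unfold f
  compute_degree!

theorem natDegree_iterate (n : ℕ) : ((f Ω).comp^[n] X).natDegree = 3 ^ n := by
  rw [natDegree_iterate_comp, natDegree_f, natDegree_X, mul_one]

theorem mem_rootSet (t : K) (n : ℕ) (z : Ω) :
    z ∈ (arborealPoly t n).rootSet Ω ↔ (fun z => (f Ω).eval z)^[n] z = algebraMap K Ω t := by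
  have hne : arborealPoly t n ≠ 0 := by
    intro h
    have h1 := congrArg (Polynomial.map (algebraMap K Ω)) h
    have h2 : ((f K).comp^[n] X).map (algebraMap K Ω) = (f Ω).comp^[n] X := by
      clear h h1
      induction n with
      | zero => simp
      | succ n ih =>
        rw [Function.iterate_succ_apply', Function.iterate_succ_apply', Polynomial.map_comp, ih, map_f]
    simp only [arborealPoly, Polynomial.map_sub, h2, Polynomial.map_C, Polynomial.map_zero] at h1
    have h3 := congrArg natDegree h1
    rw [natDegree_sub_C, natDegree_iterate, natDegree_zero] at h3
    exact absurd h3 (by positivity)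
  rw [Polynomial.mem_rootSet, and_iff_right hne, arborealPoly, map_sub, aeval_iterate, aeval_C,
    sub_eq_zero]

theorem splitField_mono [IsAlgClosed Ω] (t : K) {m n : ℕ} (h : m ≤ n) :
    splitField Ω t m ≤ splitField Ω t n := by
  obtain ⟨k, rfl⟩ := Nat.exists_eq_add_of_le h
  rw [IntermediateField.adjoin_le_iff]
  intro z hz
  rw [mem_rootSet] at hz
  have hdeg : ((f Ω).comp^[k] X - C z).degree ≠ 0 := by
    intro h0
    have := natDegree_eq_of_degree_eq_some h0
    rw [natDegree_sub_C, natDegree_iterate] at this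
    exact absurd this (by positivity)
  obtain ⟨y, hy⟩ := IsAlgClosed.exists_root _ hdeg
  have hy' : (fun z => (f Ω).eval z)^[k] y = z := by
    have := aeval_iterate (K := Ω) k y
    simp only [IsRoot.def, eval_sub, eval_C, sub_eq_zero] at hy
    rw [← this, ← hy, coe_aeval_eq_eval]
  have hyS : y ∈ splitField Ω t (m + k) := by
    apply IntermediateField.subset_adjoin
    rw [mem_rootSet, Function.iterate_add_apply, hy', hz]
  have hcoe := aeval_iterate (K := splitField Ω t (m + k)) k y
  have hc := aeval_iterate (K := K) k (⟨y, hyS⟩ : splitField Ω t (m + k))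
  have hval := aeval_algebraMap_apply Ω (⟨y, hyS⟩ : splitField Ω t (m + k)) ((f K).comp^[k] X)
  rw [← hy', ← aeval_iterate (K := K)]
  change aeval (algebraMap (splitField Ω t (m + k)) Ω ⟨y, hyS⟩) _ ∈ _
  rw [hval]
  exact SetLike.coe_mem _

/-- The profinite monodromy group: the inverse limit over `n` of the Galois groups
`Gal(fⁿ(z) - t / K)` with respect to the restriction maps. -/
def monodromy [IsAlgClosed Ω] (t : K) : Subgroup (∀ n : ℕ, Gal(splitField Ω t n/K)) where
  carrier := {σ | ∀ (m n : ℕ) (h : m ≤ n) (x : splitField Ω t m),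
    σ n (inclusion (splitField_mono t h) x) = inclusion (splitField_mono t h) (σ m x)}
  one_mem' := fun _ _ _ _ => rfl
  mul_mem' := by
    intro σ τ hσ hτ m n h x
    change σ n (τ n _) = inclusion _ (σ m (τ m x))
    rw [hτ m n h x, hσ m n h]
  inv_mem' := by
    intro σ hσ m n h x
    change (σ n).symm _ = inclusion _ ((σ m).symm x)
    rw [AlgEquiv.symm_apply_eq, hσ m n h, AlgEquiv.apply_symm_apply]

end Fields

/-- The element `t` of the subfield `k(t)` of `Ω`. -/
abbrev base (k : Type*) [Field k] {Ω : Type*} [Field Ω] [Algebra k Ω] (t : Ω) : k⟮t⟯ :=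
  AdjoinSimple.gen k t

section Monodromy

variable {Ω : Type*} [Field Ω] [CharZero Ω] {t : Ω}

theorem mem_geom_of_mem_arith {n : ℕ} {x : Ω} (hx : x ∈ splitField Ω (base ℚ t) n) :
    x ∈ splitField Ω (base (algebraicClosure ℚ Ω) t) n := by
  have hQ : ∀ y ∈ ℚ⟮t⟯, y ∈ (algebraicClosure ℚ Ω)⟮t⟯ := by
    intro y hy
    have : ℚ⟮t⟯ ≤ ((algebraicClosure ℚ Ω)⟮t⟯).restrictScalars ℚ := by
      rw [IntermediateField.adjoin_le_iff, Set.singleton_subset_iff]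
      exact mem_adjoin_simple_self _ t
    exact this hy
  refine IntermediateField.adjoin_induction _ (p := fun x _ =>
    x ∈ splitField Ω (base (algebraicClosure ℚ Ω) t) n) ?_ ?_ ?_ ?_ ?_ hx
  · intro z hz
    apply IntermediateField.subset_adjoin
    rw [mem_rootSet] at hz ⊢
    exact hz
  · intro y
    exact IntermediateField.algebraMap_mem _ (⟨y.1, hQ y.1 y.2⟩ : (algebraicClosure ℚ Ω)⟮t⟯)
  · intro _ _ _ _ h1 h2
    exact add_mem h1 h2
  · intro _ _ h
    exact inv_mem h
  · intro _ _ _ _ h1 h2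
    exact mul_mem h1 h2

/-- The inclusion `ℚ(t)(f⁻ⁿ(t)) ⊆ ℚ̄(t)(f⁻ⁿ(t))`. -/
def arithToGeom {n : ℕ} (x : splitField Ω (base ℚ t) n) :
    splitField Ω (base (algebraicClosure ℚ Ω) t) n :=
  ⟨x.1, mem_geom_of_mem_arith x.2⟩

variable [IsAlgClosed Ω] (t)

/-- The arithmetic monodromy group `lim Gal(fⁿ(z) - t / ℚ(t))`. -/
abbrev arithMonodromy : Type _ := monodromy (Ω := Ω) (base ℚ t)

/-- The geometric monodromy group `lim Gal(fⁿ(z) - t / ℚ̄(t))`. -/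
abbrev geomMonodromy : Type _ := monodromy (Ω := Ω) (base (algebraicClosure ℚ Ω) t)

end Monodromy

end Arboreal

end

open Arboreal IntermediateField

noncomputable section

namespace Arboreal

/-! ### Subgroups of powers of `S₃` -/

section PermThree

/-! The proof bounds the Galois image from above by a discriminant identity and from below by
inertia at `t = 0` and `t = ∞`.

Upper bound. For a fibre `{o₀, o₁, o₂}` of `f` over `y`, the Vandermonde product `V(y)` satisfies `4
V(y)² = 27 y (1 - y)` (`vander_sq`). Since `0` and `1` are fixed critical points, the product of `oᵢ
(1 - oᵢ)` over the fibre is `y (1 - y) / 4`, so the product of the three `V(oᵢ)` is `± 27/8 · V(y)`.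
Suitable enumerations of the fibres make the sign `+` at every vertex of the preimage tree
(`exists_next`). As `27/8` is rational, a Galois automorphism preserves these relations over any
field of constants. Comparing signs shows that it acts by an element of `E_n` (`exists_mem_E_lab`).

Lower bound. The kernel of `E_{n+2} → E_{n+1}` consists of families of elements of `S₃`, one for
each vertex of level `n + 1`, with total sign `1` on each triple of siblings. A subgroup of this
kernel that is normalised by lifts of `E_{n+1}` is everything once it contains a nontrivial element
of order two and one of order three (`mem_of_prod_sign_eq_one`), so an induction on the level
applies (`eq_E_of_exists_pow_eq_one`). The two elements come from Laurent series over `Ω`. At the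
fixed point `0` the map is ramified of order `2`, at `∞` of order `3`; with `t = X^(2^(n+1))` or `t
= X^(-3^(n+1))` the whole tree of height `n + 1` lies in `Ω((X))`, and its levels up to `n` lie in
`Ω((X^p))`. Hence `X ↦ ζX` with `ζ` of order `p` fixes level `n` and moves some vertex of level `n +
1` (`exists_gal_of_tower`).

Both bounds only need `t` to be transcendental over the field of constants (`galIsoE_base`). So the
geometric and arithmetic groups have the same finite order at every level, and the injective
restriction maps between them are isomorphisms. -/

theorem conj_eq_of_sign_eq_one : ∀ a b : Equiv.Perm (Fin 3), Equiv.Perm.sign a = 1 →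
    b * a * b⁻¹ = if Equiv.Perm.sign b = 1 then a else a⁻¹ := by
  decide

theorem pow_three_eq_one_of_sign_eq_one : ∀ a : Equiv.Perm (Fin 3), Equiv.Perm.sign a = 1 →
    a * a * a = 1 := by
  decide

theorem eq_of_sign_eq_one : ∀ a b : Equiv.Perm (Fin 3), Equiv.Perm.sign a = 1 → a ≠ 1 →
    Equiv.Perm.sign b = 1 → b = 1 ∨ b = a ∨ b = a⁻¹ := by
  decide

theorem sign_pattern : ∀ e : Fin 3 → ℤˣ, ∏ i, e i = 1 →
    (∀ i, e i = 1) ∨ ∃ i, ∀ k, e k = if k = i then 1 else -1 := by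
  decide

/-- Exactly two of the three signs are `-1`, and the same then holds for the products of cyclic
neighbours. -/
theorem sign_pattern_mul_shift : ∀ e : Fin 3 → ℤˣ, ∏ i, e i = 1 → (∃ i, e i = -1) →
    ∃ i, ∀ k, e k * e (k + 1) = if k = i then 1 else -1 := by
  decide

variable {J : Type*} [DecidableEq J] (W : Subgroup (J × Fin 3 → Equiv.Perm (Fin 3)))

open Equiv.Perm (sign)

/-- The element of `W` whose signs are `-1` exactly at two given siblings. -/
theorem exists_mem_sign_eq
    (hW : ∀ s ∈ W, ∀ j, ∏ i, sign (s (j, i)) = 1)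
    (hrot : ∀ j, ∃ p : J × Fin 3 → Equiv.Perm (Fin 3), ∀ s ∈ W,
      (fun v => (p v)⁻¹ * s (if v.1 = j then (j, v.2 + 1) else v) * p v) ∈ W)
    (hodd : ∀ v, ∃ s ∈ W, sign (s v) = -1) (j : J) (i : Fin 3) :
    ∃ s ∈ W, ∀ v, sign (s v) = if v.1 = j ∧ v.2 ≠ i then -1 else 1 := by
  obtain ⟨p, hp⟩ := hrot j
  have step : ∀ i, (∃ s ∈ W, ∀ v, sign (s v) = if v.1 = j ∧ v.2 ≠ i + 1 then -1 else 1) →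
      ∃ s ∈ W, ∀ v, sign (s v) = if v.1 = j ∧ v.2 ≠ i then -1 else 1 := by
    rintro i ⟨s, hs, h⟩
    refine ⟨_, hp s hs, fun v => ?_⟩
    have : sign ((p v)⁻¹ * s (if v.1 = j then (j, v.2 + 1) else v) * p v) =
        sign (s (if v.1 = j then (j, v.2 + 1) else v)) := by
      rw [map_mul, map_mul, mul_right_comm, ← map_mul, inv_mul_cancel, map_one, one_mul]
    rw [this, h]
    by_cases hv : v.1 = j <;> simp [hv]
  obtain ⟨s, hs, hsv⟩ := hodd (j, 0)
  obtain ⟨i₀, hi₀⟩ := sign_pattern_mul_shift (fun i => sign (s (j, i))) (hW s hs j) ⟨0, hsv⟩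
  have h0 : ∃ s ∈ W, ∀ v, sign (s v) = if v.1 = j ∧ v.2 ≠ i₀ then -1 else 1 := by
    -- Multiplying `s` by its conjugate under the rotation at `j` squares the signs away from `j`,
    -- so only the triple above `j` survives.
    refine ⟨_, W.mul_mem hs (hp s hs), fun v => ?_⟩
    have : sign ((p v)⁻¹ * s (if v.1 = j then (j, v.2 + 1) else v) * p v) =
        sign (s (if v.1 = j then (j, v.2 + 1) else v)) := by
      rw [map_mul, map_mul, mul_right_comm, ← map_mul, inv_mul_cancel, map_one, one_mul]
    rw [Pi.mul_apply, map_mul, this]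
    by_cases hv : v.1 = j
    · obtain ⟨j', k⟩ := v
      obtain rfl : j' = j := hv
      simpa using hi₀ k
    · simp [hv]
  have h1 := step (i₀ - 1) (by simpa using h0)
  have h2 := step (i₀ - 1 - 1) (by simpa using h1)
  have h3 : ∀ a b : Fin 3, b = a ∨ b = a - 1 ∨ b = a - 1 - 1 := by decide
  rcases h3 i₀ i with rfl | rfl | rfl
  exacts [h0, h1, h2]

/-- `W` is analysed through the sign map. Commutators with the elements of `exists_mem_sign_eq`
isolate a three-cycle at a single vertex, transitivity spreads it to all vertices, and so `W`
contains all families of even permutations. It then remains to realise the sign vectors, for which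
the same elements suffice. -/
theorem mem_of_prod_sign_eq_one [Fintype J]
    (hW : ∀ s ∈ W, ∀ j, ∏ i, sign (s (j, i)) = 1)
    (hrot : ∀ j, ∃ p : J × Fin 3 → Equiv.Perm (Fin 3), ∀ s ∈ W,
      (fun v => (p v)⁻¹ * s (if v.1 = j then (j, v.2 + 1) else v) * p v) ∈ W)
    (htrans : ∀ v v' : J × Fin 3, ∃ c : J × Fin 3 → J × Fin 3, Function.Injective c ∧ c v = v' ∧
      ∃ p : J × Fin 3 → Equiv.Perm (Fin 3), ∀ s ∈ W, (fun u => (p u)⁻¹ * s (c u) * p u) ∈ W)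
    (h2 : ∃ s ∈ W, ∃ v, sign (s v) = -1)
    (h3 : ∃ s ∈ W, s ≠ 1 ∧ ∀ v, sign (s v) = 1)
    (s : J × Fin 3 → Equiv.Perm (Fin 3)) (hs : ∀ j, ∏ i, sign (s (j, i)) = 1) : s ∈ W := by
  have hodd : ∀ v, ∃ s ∈ W, sign (s v) = -1 := by
    intro v
    obtain ⟨s, hs, v', hv'⟩ := h2
    obtain ⟨c, -, hc, p, hp⟩ := htrans v v'
    refine ⟨_, hp s hs, ?_⟩
    rw [map_mul, map_mul, mul_right_comm, ← map_mul, inv_mul_cancel, map_one, one_mul, hc, hv']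
  have hpair := exists_mem_sign_eq W hW hrot hodd
  -- conjugation by an element `e` kills the even coordinates at which `e` is even
  have hkill : ∀ e ∈ W, ∀ y ∈ W, (∀ v, sign (y v) = 1) →
      ∃ z ∈ W, ∀ v, z v = if sign (e v) = 1 then 1 else y v * y v := by
    intro e he y hy hy1
    -- This commutator is `y y⁻¹ = 1` where `e` is even, and `y y` where `e` is odd, as an odd
    -- permutation inverts three-cycles.
    refine ⟨y * (e * y * e⁻¹)⁻¹, W.mul_mem hy (W.inv_mem (W.mul_mem (W.mul_mem he hy)
      (W.inv_mem he))), fun v => ?_⟩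
    have := conj_eq_of_sign_eq_one (y v) (e v) (hy1 v)
    rw [Pi.mul_apply, Pi.inv_apply, Pi.mul_apply, Pi.mul_apply, Pi.inv_apply, this]
    split_ifs <;> simp
  -- a three-cycle supported at one vertex
  have hone : ∃ (v : J × Fin 3) (a : Equiv.Perm (Fin 3)), sign a = 1 ∧ a ≠ 1 ∧
      Pi.mulSingle v a ∈ W := by
    obtain ⟨y, hy, hne, hy1⟩ := h3
    obtain ⟨v, hv⟩ := Function.ne_iff.mp hne
    -- Among the siblings of `v`, `e₁` is even only at the next one and `e₂` only at the one after;
    -- both are even at all other triples. The only vertex at which both are odd is `v`, where two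
    -- commutators turn `y v` into its fourth power, that is, `y v` itself.
    obtain ⟨e₁, he₁, h₁⟩ := hpair v.1 (v.2 + 1)
    obtain ⟨e₂, he₂, h₂⟩ := hpair v.1 (v.2 + 2)
    obtain ⟨z, hz, hz'⟩ := hkill e₁ he₁ y hy hy1
    have hz1 : ∀ u, sign (z u) = 1 := by
      intro u
      rw [hz']
      split_ifs
      · exact map_one _
      · rw [map_mul, hy1, one_mul]
    obtain ⟨x, hx, hx'⟩ := hkill e₂ he₂ z hz hz1
    refine ⟨v, y v, hy1 v, hv, ?_⟩
    convert hx using 1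
    funext u
    rw [hx', hz', h₁, h₂]
    have hsplit : ∀ a b : Fin 3, b ≠ a → b = a + 1 ∨ b = a + 2 := by decide
    have hd1 : ∀ a : Fin 3, a ≠ a + 1 ∧ a ≠ a + 2 := by decide
    by_cases huv : u = v
    · subst huv
      have h4 : y u * y u * (y u * y u) = y u := by
        rw [← mul_assoc, pow_three_eq_one_of_sign_eq_one _ (hy1 u), one_mul]
      simp [hd1, h4]
    · rw [Pi.mulSingle_eq_of_ne huv]
      by_cases h1 : u.1 = v.1
      · have : u.2 ≠ v.2 := fun h => huv (Prod.ext h1 h)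
        rcases hsplit _ _ this with h | h <;> simp [h, h1]
      · simp [h1]
  have hall : ∀ (v : J × Fin 3) (a : Equiv.Perm (Fin 3)), sign a = 1 →
      Pi.mulSingle v a ∈ W := by
    intro v b hb
    obtain ⟨v', a, ha, hne, haW⟩ := hone
    obtain ⟨c, hcinj, hc, p, hp⟩ := htrans v v'
    have hmem := hp _ haW
    have heq : (fun u => (p u)⁻¹ * (Pi.mulSingle v' a : J × Fin 3 → Equiv.Perm (Fin 3)) (c u) * p u)
        = Pi.mulSingle v ((p v)⁻¹ * a * p v) := by
      funext u
      by_cases hu : u = v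
      · subst hu
        simp [hc]
      · have : c u ≠ v' := fun h => hu (hcinj (h.trans hc.symm))
        simp [Pi.mulSingle_eq_of_ne this, Pi.mulSingle_eq_of_ne hu]
    rw [heq] at hmem
    rcases eq_of_sign_eq_one ((p v)⁻¹ * a * p v) b (by
      rw [map_mul, map_mul, mul_right_comm, ← map_mul, inv_mul_cancel, map_one, one_mul, ha])
      (fun h => hne (by
        have := congrArg (fun x => p v * x * (p v)⁻¹) h
        simpa [mul_assoc] using this)) hb with rfl | rfl | rfl
    · rw [Pi.mulSingle_one]
      exact W.one_mem
    · exact hmem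
    · rw [Pi.mulSingle_inv]
      exact W.inv_mem hmem
  have heven : ∀ y : J × Fin 3 → Equiv.Perm (Fin 3), (∀ v, sign (y v) = 1) → y ∈ W :=
    fun y hy => Subgroup.pi_mem_of_mulSingle_mem y fun v => hall v _ (hy v)
  -- the signs of `s` are attained in `W`
  let S : (J × Fin 3 → Equiv.Perm (Fin 3)) →* (J × Fin 3 → ℤˣ) :=
    MonoidHom.compLeft (Equiv.Perm.sign : Equiv.Perm (Fin 3) →* ℤˣ) (J × Fin 3)
  have hS : ∀ x v, S x v = sign (x v) := fun _ _ => rfl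
  have hmem : S s ∈ W.map S := by
    -- The sign vector splits into its parts on the sibling triples; each part is trivial or has
    -- exactly two entries `-1`.
    have hprod : S s = ∏ j : J, fun v => if v.1 = j then sign (s v) else 1 := by
      funext v
      rw [Finset.prod_apply, Finset.prod_ite_eq, if_pos (Finset.mem_univ _), hS]
    rw [hprod]
    refine Subgroup.prod_mem _ fun j _ => ?_
    rcases sign_pattern _ (hs j) with h | ⟨i, hi⟩
    · convert (W.map S).one_mem
      rename_i v
      obtain ⟨j', k⟩ := v
      by_cases hj : j' = j
      · subst hj
        simp [h]
      · simp [hj]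
    · obtain ⟨e, he, he'⟩ := hpair j i
      refine ⟨e, he, ?_⟩
      funext v
      obtain ⟨j', k⟩ := v
      rw [hS, he']
      by_cases hj : j' = j
      · subst hj
        by_cases hk : k = i <;> simp [hi, hk]
      · simp [hj]
  obtain ⟨d, hd, hds⟩ := hmem
  have : s * d⁻¹ ∈ W := by
    refine heven _ fun v => ?_
    have := congrFun hds v
    rw [hS, hS] at this
    rw [Pi.mul_apply, Pi.inv_apply, map_mul, map_inv, this, mul_inv_cancel]
  simpa using W.mul_mem this hd

end PermThree

/-! ### Automorphisms of `T_n` as maps of words -/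

section Words

variable {n : ℕ}

/-- The action of an automorphism of `T_n` on words, extended by the identity to the words of
length more than `n`. -/
def act (g : AutT n) (l : List (Fin 3)) : List (Fin 3) :=
  if h : l.length ≤ n then (g.1 ⟨l, h⟩).1 else l

theorem act_of_le (g : AutT n) {l : List (Fin 3)} (h : l.length ≤ n) :
    act g l = (g.1 ⟨l, h⟩).1 := dif_pos h

theorem act_coe (g : AutT n) (v : Vertex n) : act g v.1 = (g.1 v).1 := act_of_le g v.2

@[simp]
theorem length_act (g : AutT n) (l : List (Fin 3)) : (act g l).length = l.length := by
  by_cases h : l.length ≤ n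
  · rw [act_of_le g h]
    exact level_apply g ⟨l, h⟩
  · rw [act, dif_neg h]

theorem act_dropLast (g : AutT n) {l : List (Fin 3)} (h : l.length ≤ n) :
    act g l.dropLast = (act g l).dropLast := by
  have h' : l.dropLast.length ≤ n := by rw [List.length_dropLast]; omega
  rw [act_of_le g h, act_of_le g h']
  exact congrArg Subtype.val (g.2 ⟨l, h⟩)

theorem act_mul (g h : AutT n) (l : List (Fin 3)) : act (g * h) l = act g (act h l) := by
  by_cases hl : l.length ≤ n
  · rw [act_of_le _ hl, act_of_le h hl, act_coe]
    rfl
  · simp [act, hl]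

@[simp]
theorem act_one (l : List (Fin 3)) : act (1 : AutT n) l = l := by
  by_cases hl : l.length ≤ n
  · rw [act_of_le _ hl]
    rfl
  · simp [act, hl]

@[simp]
theorem act_inv_act (g : AutT n) (l : List (Fin 3)) : act g⁻¹ (act g l) = l := by
  rw [← act_mul, inv_mul_cancel, act_one]

@[simp]
theorem act_act_inv (g : AutT n) (l : List (Fin 3)) : act g (act g⁻¹ l) = l := by
  rw [← act_mul, mul_inv_cancel, act_one]

theorem act_injective (g : AutT n) : Function.Injective (act g) :=
  Function.LeftInverse.injective (act_inv_act g)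

theorem ext_act {g h : AutT n} (H : ∀ l : List (Fin 3), l.length ≤ n → act g l = act h l) :
    g = h := by
  refine Subtype.ext (Equiv.ext fun v => Subtype.ext ?_)
  rw [← act_coe, ← act_coe]
  exact H v.1 v.2

/-- It suffices to compare automorphisms of the tree on the words of maximal length. -/
theorem ext_act_of_length_eq {g h : AutT n}
    (H : ∀ l : List (Fin 3), l.length = n → act g l = act h l) : g = h := by
  have key : ∀ k l, l.length + k = n → act g l = act h l := by
    intro k
    induction k with
    | zero => exact fun l hl => H l hl
    | succ k ih =>
      intro l hl
      have h1 := ih (l ++ [0]) (by simp; omega)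
      have h2 := congrArg List.dropLast h1
      rw [← act_dropLast _ (by simp; omega), ← act_dropLast _ (by simp; omega)] at h2
      simpa using h2
  exact ext_act fun l hl => key (n - l.length) l (by omega)

theorem exists_act_eq (F : List (Fin 3) → List (Fin 3)) (hlen : ∀ l, (F l).length = l.length)
    (hinj : ∀ l l', l.length ≤ n → l'.length ≤ n → F l = F l' → l = l')
    (hdrop : ∀ l, l.length ≤ n → F l.dropLast = (F l).dropLast) :
    ∃ g : AutT n, ∀ l, l.length ≤ n → act g l = F l := by
  let φ : Vertex n → Vertex n := fun v => ⟨F v.1, by rw [hlen]; exact v.2⟩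
  have hφ : Function.Bijective φ := by
    rw [← Finite.injective_iff_bijective]
    intro v w h
    exact Subtype.ext (hinj _ _ v.2 w.2 (congrArg Subtype.val h))
  refine ⟨⟨Equiv.ofBijective φ hφ, fun v => Subtype.ext (hdrop v.1 v.2)⟩, fun l hl => ?_⟩
  rw [act_of_le _ hl]
  rfl

theorem act_nil (g : AutT n) : act g [] = [] := by
  rw [← List.length_eq_zero_iff, length_act, List.length_nil]

/-- The permutations that an automorphism induces on the children of the vertices. -/
theorem exists_act_append (g : AutT (n + 1)) : ∃ p : List (Fin 3) → Equiv.Perm (Fin 3),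
    ∀ l, l.length ≤ n → ∀ k, act g (l ++ [k]) = act g l ++ [p l k] := by
  have h1 : ∀ l, ∃ q : Equiv.Perm (Fin 3), l.length ≤ n →
      ∀ k, act g (l ++ [k]) = act g l ++ [q k] := by
    intro l
    by_cases hl : l.length ≤ n
    · have h2 : ∀ k, ∃ j, act g (l ++ [k]) = act g l ++ [j] := by
        intro k
        have h3 := act_dropLast g (l := l ++ [k]) (by simpa using hl)
        have h4 : act g (l ++ [k]) ≠ [] := by
          rw [← List.length_pos_iff, length_act]
          simp
        refine ⟨(act g (l ++ [k])).getLast h4, ?_⟩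
        rw [List.dropLast_concat] at h3
        rw [h3, List.dropLast_append_getLast]
      choose q hq using h2
      have hinj : Function.Injective q := by
        intro j k hjk
        have : act g (l ++ [j]) = act g (l ++ [k]) := by rw [hq, hq, hjk]
        simpa using act_injective g this
      exact ⟨Equiv.ofBijective q (Finite.injective_iff_bijective.mp hinj), fun _ k => hq k⟩
    · exact ⟨1, fun h => absurd h hl⟩
  choose p hp using h1
  exact ⟨p, hp⟩

/-- Restriction of automorphisms of `T_{n+1}` to `T_n`. -/
def res : AutT (n + 1) →* AutT n where
  toFun g :=
    ⟨{ toFun := fun v => ⟨act g v.1, (length_act g v.1).trans_le v.2⟩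
       invFun := fun v => ⟨act g⁻¹ v.1, (length_act g⁻¹ v.1).trans_le v.2⟩
       left_inv := fun v => Subtype.ext (act_inv_act g v.1)
       right_inv := fun v => Subtype.ext (act_act_inv g v.1) },
     fun v => Subtype.ext (act_dropLast g (v.2.trans (Nat.le_succ n)))⟩
  map_one' := Subtype.ext (Equiv.ext fun v => Subtype.ext (act_one v.1))
  map_mul' g h := Subtype.ext (Equiv.ext fun v => Subtype.ext (act_mul g h v.1))

theorem act_res (g : AutT (n + 1)) {l : List (Fin 3)} (h : l.length ≤ n) :
    act (res g) l = act g l := by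
  rw [act_of_le _ h]
  rfl

/-- The automorphism `g` of `T_{n+1}` is the element `(a, b)` of `Aut(T_n) ≀ Aut(T_1)`. -/
def IsWreath (g : AutT (n + 1)) (a : Fin 3 → AutT n) (b : Equiv.Perm (Fin 3)) : Prop :=
  ∀ i l, l.length ≤ n → act g (i :: l) = b i :: act (a i) l

theorem mem_wreath_iff {H : Subgroup (AutT n)} {g : AutT (n + 1)} :
    g ∈ wreath H ↔ ∃ a b, (∀ i, a i ∈ H) ∧ IsWreath g a b := by
  constructor
  · rintro ⟨a, b, ha, h⟩
    refine ⟨a, b, ha, fun i l hl => ?_⟩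
    rw [act_of_le (a i) hl, act_of_le g (l := i :: l) (by simpa using hl)]
    exact congrArg Subtype.val (h i ⟨l, hl⟩)
  · rintro ⟨a, b, ha, h⟩
    refine ⟨a, b, ha, fun i w => Subtype.ext ?_⟩
    rw [← act_coe]
    exact (h i w.1 w.2).trans (by rw [act_coe]; rfl)

theorem exists_isWreath (a : Fin 3 → AutT n) (b : Equiv.Perm (Fin 3)) :
    ∃ g, IsWreath g a b := by
  let F : List (Fin 3) → List (Fin 3) := fun l =>
    match l with
    | [] => []
    | i :: w => b i :: act (a i) w
  obtain ⟨g, hg⟩ := exists_act_eq (n := n + 1) F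
    (by rintro (_ | ⟨i, w⟩) <;> simp [F])
    (by
      rintro (_ | ⟨i, w⟩) (_ | ⟨j, u⟩) - - h
      · rfl
      · simp [F] at h
      · simp [F] at h
      · simp only [F, List.cons.injEq, EmbeddingLike.apply_eq_iff_eq] at h
        obtain ⟨rfl, h⟩ := h
        rw [act_injective _ h])
    (by
      rintro (_ | ⟨i, _ | ⟨j, w⟩⟩) h
      · rfl
      · simp [F, act_nil]
      · have hne : act (a i) (j :: w) ≠ [] := by
          rw [← List.length_pos_iff, length_act]
          simp
        simp only [F, List.dropLast_cons_cons]
        rw [List.dropLast_cons_of_ne_nil hne, act_dropLast _ (by simpa using h)])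
  exact ⟨g, fun i l hl => hg (i :: l) (by simpa using hl)⟩

theorem IsWreath.act_singleton {g : AutT (n + 1)} {a : Fin 3 → AutT n} {b : Equiv.Perm (Fin 3)}
    (h : IsWreath g a b) (i : Fin 3) : act g [i] = [b i] := by
  rw [h i [] (Nat.zero_le n), act_nil]

theorem sgn_one_eq {g : AutT (n + 1)} {β : Equiv.Perm (Fin 3)} (h : ∀ j, act g [j] = [β j]) :
    sgn (n + 1) 1 g = Equiv.Perm.sign β := by
  let e : Fin 3 → {v : Vertex (n + 1) // v.level = 1} :=
    fun j => ⟨⟨[j], by simp⟩, rfl⟩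
  have he : Function.Bijective e := by
    constructor
    · intro j k hjk
      simpa [e] using congrArg (fun x => x.1.1) hjk
    · rintro ⟨⟨v, hv⟩, hv1⟩
      obtain ⟨j, rfl⟩ := List.length_eq_one_iff.mp hv1
      exact ⟨j, rfl⟩
  refine (Equiv.Perm.sign_eq_sign_of_equiv β _ (Equiv.ofBijective e he) fun j => ?_).symm
  refine Subtype.ext (Subtype.ext ?_)
  change [β j] = (g.1 (e j).1).1
  rw [← act_coe, ← h j]

theorem sgn_two_eq {g : AutT (n + 2)} {b : Equiv.Perm (Fin 3)} {β : Fin 3 → Equiv.Perm (Fin 3)}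
    (h : ∀ i j, act g [i, j] = [b i, β i j]) :
    sgn (n + 2) 2 g = Equiv.Perm.sign b * ∏ i, Equiv.Perm.sign (β i) := by
  let e : Fin 3 × Fin 3 → {v : Vertex (n + 2) // v.level = 2} :=
    fun p => ⟨⟨[p.1, p.2], by simp⟩, rfl⟩
  have he : Function.Bijective e := by
    constructor
    · rintro ⟨i, j⟩ ⟨k, l⟩ hjk
      simpa [e] using congrArg (fun x => x.1.1) hjk
    · rintro ⟨⟨v, hv⟩, hv1⟩
      obtain ⟨i, j, rfl⟩ := List.length_eq_two.mp hv1
      exact ⟨(i, j), rfl⟩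
  let P : Equiv.Perm (Fin 3 × Fin 3) :=
    (Equiv.prodCongrLeft fun _ : Fin 3 => b) * Equiv.prodCongrRight β
  have hP : Equiv.Perm.sign P = Equiv.Perm.sign b * ∏ i, Equiv.Perm.sign (β i) := by
    -- The permutation `b` acts on three parallel copies of level one, so it contributes the cube of
    -- its sign.
    have h3 : ∀ s : ℤˣ, s ^ 3 = s := by decide
    simp only [P]
    rw [map_mul, Equiv.Perm.sign_prodCongrLeft, Equiv.Perm.sign_prodCongrRight,
      Finset.prod_const, Finset.card_univ, Fintype.card_fin, h3]
  rw [← hP]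
  refine (Equiv.Perm.sign_eq_sign_of_equiv P _ (Equiv.ofBijective e he) fun p => ?_).symm
  refine Subtype.ext (Subtype.ext ?_)
  change [b p.1, β p.1 p.2] = (g.1 (e p).1).1
  rw [← act_coe, ← h p.1 p.2]

theorem exists_act_singleton (g : AutT (n + 1)) :
    ∃ β : Equiv.Perm (Fin 3), ∀ j, act g [j] = [β j] := by
  obtain ⟨p, hp⟩ := exists_act_append g
  exact ⟨p [], fun j => by simpa [act_nil] using hp [] (by simp) j⟩

theorem IsWreath.sgn_two {g : AutT (n + 2)} {a : Fin 3 → AutT (n + 1)} {b : Equiv.Perm (Fin 3)}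
    (h : IsWreath g a b) :
    sgn (n + 2) 2 g = Equiv.Perm.sign b * ∏ i, sgn (n + 1) 1 (a i) := by
  choose β hβ using fun i => exists_act_singleton (a i)
  rw [sgn_two_eq (b := b) (β := β) fun i j => by rw [h i [j] (by simp), hβ]]
  congr 1
  exact Finset.prod_congr rfl fun i _ => (sgn_one_eq (hβ i)).symm

theorem IsWreath.mem_E {g : AutT (n + 2)} {a : Fin 3 → AutT (n + 1)} {b : Equiv.Perm (Fin 3)}
    (h : IsWreath g a b) (ha : ∀ i, a i ∈ E (n + 1))
    (hs : Equiv.Perm.sign b * ∏ i, sgn (n + 1) 1 (a i) = 1) : g ∈ E (n + 2) :=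
  ⟨mem_wreath_iff.mpr ⟨a, b, ha, h⟩, h.sgn_two.trans hs⟩

theorem exists_isWreath_of_mem_E {g : AutT (n + 2)} (hg : g ∈ E (n + 2)) :
    ∃ a b, IsWreath g a b ∧ (∀ i, a i ∈ E (n + 1)) ∧
      Equiv.Perm.sign b * ∏ i, sgn (n + 1) 1 (a i) = 1 := by
  obtain ⟨h1, h2⟩ := hg
  obtain ⟨a, b, ha, h⟩ := mem_wreath_iff.mp h1
  exact ⟨a, b, h, ha, h.sgn_two.symm.trans h2⟩

theorem sgn_one_res (g : AutT (n + 2)) : sgn (n + 1) 1 (res g) = sgn (n + 2) 1 g := by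
  obtain ⟨β, hβ⟩ := exists_act_singleton g
  rw [sgn_one_eq hβ, sgn_one_eq fun j => (act_res g (by simp)).trans (hβ j)]

theorem IsWreath.res {g : AutT (n + 2)} {a : Fin 3 → AutT (n + 1)} {b : Equiv.Perm (Fin 3)}
    (h : IsWreath g a b) : IsWreath (res g) (fun i => Arboreal.res (a i)) b := by
  intro i l hl
  rw [act_res g (by simpa using hl), h i l (by omega), act_res (a i) hl]

/-- The sign condition at the root of each subtree involves only the two levels directly above that
root, so truncation at the top either keeps the condition or removes it together with one of these
levels. -/
theorem res_mem_E : ∀ {n : ℕ} {g : AutT (n + 1)}, g ∈ E (n + 1) → res g ∈ E n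
  | 0, _, _ => Subgroup.mem_top _
  | 1, _, _ => Subgroup.mem_top _
  | n + 2, g, hg => by
    obtain ⟨a, b, h, ha, hs⟩ := exists_isWreath_of_mem_E hg
    refine h.res.mem_E (fun i => res_mem_E (ha i)) ?_
    simpa only [sgn_one_res] using hs

/-- `E_n` is transitive on the vertices of level `n`. -/
theorem exists_mem_E_act_eq : ∀ (n : ℕ) (v w : List (Fin 3)), v.length = n → w.length = n →
    ∃ g ∈ E n, act g v = w
  | 0, v, w, hv, hw => by
    rw [List.length_eq_zero_iff] at hv hw
    exact ⟨1, (E 0).one_mem, by rw [hv, hw, act_one]⟩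
  | 1, v, w, hv, hw => by
    obtain ⟨i, rfl⟩ := List.length_eq_one_iff.mp hv
    obtain ⟨j, rfl⟩ := List.length_eq_one_iff.mp hw
    obtain ⟨g, hg⟩ := exists_isWreath (n := 0) (fun _ => 1) (Equiv.swap i j)
    exact ⟨g, Subgroup.mem_top _, by rw [hg.act_singleton, Equiv.swap_apply_left]⟩
  | n + 2, v, w, hv, hw => by
    obtain ⟨i, v, rfl⟩ := List.exists_cons_of_length_eq_add_one hv
    obtain ⟨j, w, rfl⟩ := List.exists_cons_of_length_eq_add_one hw
    obtain ⟨a, ha, hav⟩ := exists_mem_E_act_eq (n + 1) v w (by simpa using hv) (by simpa using hw)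
    -- The rotation at the root is even. Putting `a` on the subtree above `i`, where it is needed,
    -- and on exactly one further subtree makes its sign occur twice and cancel.
    obtain ⟨g, hg⟩ := exists_isWreath (fun k => if k = i + 1 then 1 else a) (Equiv.addRight (j - i))
    refine ⟨g, hg.mem_E (fun k => ?_) ?_, ?_⟩
    · split_ifs
      exacts [(E (n + 1)).one_mem, ha]
    · have h1 : ∀ k : Fin 3, Equiv.Perm.sign (Equiv.addRight k) = 1 := by decide
      have h2 : ∀ (s : ℤˣ) (i : Fin 3), ∏ k, (if k = i + 1 then 1 else s) = 1 := by decide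
      rw [h1, one_mul, ← h2 (sgn (n + 1) 1 a) i]
      refine Finset.prod_congr rfl fun k _ => ?_
      split_ifs
      exacts [map_one _, rfl]
    · have h1 : ∀ i : Fin 3, i ≠ i + 1 := by decide
      rw [hg i v (by simpa using hv.le)]
      simp [h1, hav]

theorem sgn_one_eq_one {g : AutT (n + 1)} (h : ∀ j, act g [j] = [j]) : sgn (n + 1) 1 g = 1 :=
  (sgn_one_eq (β := 1) h).trans (map_one _)

/-- `E_{n+1}` contains the rotations of the children of a vertex of level `n`. -/
theorem exists_mem_E_rotation : ∀ (n : ℕ) (w : List (Fin 3)), w.length = n →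
    ∃ g ∈ E (n + 1), ∀ v k, v.length = n →
      act g (v ++ [k]) = if v = w then v ++ [k + 1] else v ++ [k]
  | 0, w, hw => by
    obtain ⟨g, hg⟩ := exists_isWreath (n := 0) (fun _ => 1) (Equiv.addRight 1)
    refine ⟨g, Subgroup.mem_top _, fun v k hv => ?_⟩
    rw [List.length_eq_zero_iff] at hv hw
    subst hv hw
    simpa using hg.act_singleton k
  | n + 1, w, hw => by
    obtain ⟨i, w, rfl⟩ := List.exists_cons_of_length_eq_add_one hw
    obtain ⟨a, ha, haw⟩ := exists_mem_E_rotation n w (by simpa using hw)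
    obtain ⟨g, hg⟩ := exists_isWreath (fun k => if k = i then a else 1) 1
    -- For `n = 0` the element `a` is a three-cycle on level one; for larger `n` it acts only on the
    -- top level and so fixes level one pointwise.
    have hsgn : sgn (n + 1) 1 a = 1 := by
      rcases n with _ | n
      · have hw0 : w = [] := by simpa using hw
        subst hw0
        have h1 := sgn_one_eq (g := a) (β := Equiv.addRight 1)
          fun j => by simpa using haw [] j rfl
        rw [h1]
        decide
      · refine sgn_one_eq_one fun j => ?_
        have h1 := haw (j :: List.replicate n 0) 0 (by simp)
        have h2 := congrArg (fun l => l.take 1) h1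
        have h3 : ∀ m l, l.length ≤ n + 2 → act a (l.take m) = (act a l).take m := by
          intro m l
          induction l using List.reverseRecOn with
          | nil => simp [act_nil]
          | append_singleton l x ih =>
            intro hl
            rcases le_or_gt m l.length with hm | hm
            · have h4 : act a l = (act a (l ++ [x])).dropLast := by
                rw [← act_dropLast a hl, List.dropLast_concat]
              rw [List.take_append_of_le_length hm, ih (by simp at hl; omega), h4,
                List.dropLast_eq_take, List.take_take, length_act]
              congr 1
              simp
              omega
            · rw [List.take_of_length_le (by simp; omega), List.take_of_length_le (by simp; omega)]
        rw [← h3 1 _ (by simp)] at h2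
        split_ifs at h2 <;> simpa using h2
    refine ⟨g, hg.mem_E (fun k => ?_) ?_, fun v k hv => ?_⟩
    · split_ifs
      exacts [ha, (E (n + 1)).one_mem]
    · rw [map_one, one_mul]
      refine Finset.prod_eq_one fun k _ => ?_
      split_ifs
      exacts [hsgn, map_one _]
    · obtain ⟨j, v, rfl⟩ := List.exists_cons_of_length_eq_add_one hv
      have hv' : v.length = n := by simpa using hv
      rw [List.cons_append, hg j _ (by simp [hv'])]
      by_cases hj : j = i
      · subst hj
        simp only [if_true, haw v k hv', List.cons.injEq, true_and, Equiv.Perm.one_apply,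
          List.cons_append]
        split_ifs <;> rfl
      · simp [hj]

/-- The elements of `E_{n+2}` that fix the vertices of level `n + 1` permute the children of
siblings with total sign `1`. -/
theorem prod_sign_eq_one_of_mem_E : ∀ (n : ℕ) {g : AutT (n + 2)}, g ∈ E (n + 2) →
    ∀ s : List (Fin 3) → Equiv.Perm (Fin 3),
    (∀ v k, v.length = n + 1 → act g (v ++ [k]) = v ++ [s v k]) →
    ∀ w : List (Fin 3), w.length = n → ∏ i, Equiv.Perm.sign (s (w ++ [i])) = 1
  | 0, g, hg, s, hs, w, hw => by
    rw [List.length_eq_zero_iff] at hw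
    subst hw
    have h1 := sgn_two_eq (g := g) (b := 1) (β := fun i => s [i]) fun i j => by
      simpa using hs [i] j rfl
    rw [map_one, one_mul] at h1
    exact h1.symm.trans hg.2
  | n + 1, g, hg, s, hs, w, hw => by
    obtain ⟨i, w, rfl⟩ := List.exists_cons_of_length_eq_add_one hw
    obtain ⟨a, b, h, ha, -⟩ := exists_isWreath_of_mem_E hg
    refine prod_sign_eq_one_of_mem_E n (ha i) (fun v => s (i :: v)) (fun v k hv => ?_) w
      (by simpa using hw)
    have h1 := hs (i :: v) k (by simpa using hv)
    rw [List.cons_append, h i (v ++ [k]) (by simp [hv])] at h1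
    simpa using (List.cons.inj h1).2

end Words

/-! ### Generation of `E_n` by elements acting on the highest level -/

section Generation

open Equiv.Perm (sign)

/-- The words of length `n`. -/
abbrev Words (n : ℕ) : Type := {l : List (Fin 3) // l.length = n}

instance (n : ℕ) : Fintype (Words n) :=
  @Fintype.ofFinite _ ((List.finite_length_eq (Fin 3) n).to_subtype)

variable {n : ℕ}

/-- The automorphism `g` of `T_{n+2}` fixes the vertices of level `n + 1` and acts by `s v` on the
children of the vertex `v` of level `n + 1`. -/
def IsLeaf (g : AutT (n + 2)) (s : Words n × Fin 3 → Equiv.Perm (Fin 3)) : Prop :=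
  ∀ (w : Words n) (i k : Fin 3), act g (w.1 ++ [i] ++ [k]) = w.1 ++ [i] ++ [s (w, i) k]

theorem exists_words_eq {v : List (Fin 3)} (hv : v.length = n + 1) :
    ∃ (w : Words n) (i : Fin 3), v = w.1 ++ [i] := by
  have hne : v ≠ [] := by
    rw [← List.length_pos_iff]
    omega
  exact ⟨⟨v.dropLast, by rw [List.length_dropLast]; omega⟩, v.getLast hne,
    (List.dropLast_append_getLast hne).symm⟩

theorem IsLeaf.ext {g h : AutT (n + 2)} {s : Words n × Fin 3 → Equiv.Perm (Fin 3)}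
    (hg : IsLeaf g s) (hh : IsLeaf h s) : g = h := by
  refine ext_act_of_length_eq fun l hl => ?_
  obtain ⟨v, k, rfl⟩ := exists_words_eq hl
  obtain ⟨w, i, hv⟩ := exists_words_eq v.2
  rw [hv, hg, hh]

theorem IsLeaf.eq {g : AutT (n + 2)} {s s' : Words n × Fin 3 → Equiv.Perm (Fin 3)}
    (hg : IsLeaf g s) (hg' : IsLeaf g s') : s = s' := by
  funext ⟨w, i⟩
  ext1 k
  have := (hg w i k).symm.trans (hg' w i k)
  simpa using this

theorem isLeaf_one : IsLeaf (1 : AutT (n + 2)) 1 := fun _ _ _ => act_one _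

theorem IsLeaf.mul {g g' : AutT (n + 2)} {s s' : Words n × Fin 3 → Equiv.Perm (Fin 3)}
    (h : IsLeaf g s) (h' : IsLeaf g' s') : IsLeaf (g * g') (s * s') := by
  intro w i k
  rw [act_mul, h', h]
  rfl

theorem IsLeaf.inv {g : AutT (n + 2)} {s : Words n × Fin 3 → Equiv.Perm (Fin 3)}
    (h : IsLeaf g s) : IsLeaf g⁻¹ s⁻¹ := by
  intro w i k
  apply act_injective g
  rw [act_act_inv, h]
  simp

theorem IsLeaf.pow {g : AutT (n + 2)} {s : Words n × Fin 3 → Equiv.Perm (Fin 3)}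
    (h : IsLeaf g s) (k : ℕ) : IsLeaf (g ^ k) (s ^ k) := by
  induction k with
  | zero => exact isLeaf_one
  | succ k ih =>
    rw [pow_succ, pow_succ]
    exact ih.mul h

theorem exists_isLeaf {g : AutT (n + 2)} (hg : res g = 1) : ∃ s, IsLeaf g s := by
  obtain ⟨p, hp⟩ := exists_act_append g
  refine ⟨fun v => p (v.1.1 ++ [v.2]), fun w i k => ?_⟩
  have hl : (w.1 ++ [i]).length ≤ n + 1 := by simp [w.2]
  rw [hp _ hl, ← act_res g hl, hg, act_one]

theorem IsLeaf.prod_sign_eq_one {g : AutT (n + 2)} {s : Words n × Fin 3 → Equiv.Perm (Fin 3)}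
    (h : IsLeaf g s) (hg : g ∈ E (n + 2)) (w : Words n) : ∏ i, sign (s (w, i)) = 1 := by
  -- An extension of `s` to all words; its value `1` at words of other lengths is immaterial.
  let s' : List (Fin 3) → Equiv.Perm (Fin 3) := fun v =>
    if hv : ∃ (w : Words n) (i : Fin 3), v = w.1 ++ [i] then
      s (hv.choose, hv.choose_spec.choose) else 1
  have hs' : ∀ (w : Words n) i, s' (w.1 ++ [i]) = s (w, i) := by
    intro w i
    have hv : ∃ (u : Words n) (j : Fin 3), w.1 ++ [i] = u.1 ++ [j] := ⟨w, i, rfl⟩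
    have h1 := hv.choose_spec.choose_spec
    have h2 := List.append_inj' h1 rfl
    have h3 : hv.choose = w := Subtype.ext h2.1.symm
    have h4 : hv.choose_spec.choose = i := by simpa using h2.2.symm
    simp only [s']
    rw [dif_pos hv, h4, h3]
  have := prod_sign_eq_one_of_mem_E n hg s' (fun v k hv => by
    obtain ⟨u, j, rfl⟩ := exists_words_eq hv
    rw [h, hs']) w.1 w.2
  simpa only [hs'] using this

/-- The subgroup of the elements of `G` that act only on the vertices of the highest level. -/
def leafSubgroup (G : Subgroup (AutT (n + 2))) :
    Subgroup (Words n × Fin 3 → Equiv.Perm (Fin 3)) where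
  carrier := {s | ∃ g ∈ G, IsLeaf g s}
  one_mem' := ⟨1, G.one_mem, isLeaf_one⟩
  mul_mem' := fun ⟨g, hg, h⟩ ⟨g', hg', h'⟩ => ⟨g * g', G.mul_mem hg hg', h.mul h'⟩
  inv_mem' := fun ⟨g, hg, h⟩ => ⟨g⁻¹, G.inv_mem hg, h.inv⟩

/-- Conjugation by `h` permutes the coordinates through the action of `h` on level `n + 1`, and
conjugates each coordinate by the local permutation `p v`. The latter need not be known: signs and
nontriviality are invariant under it. -/
theorem exists_conj_mem_leafSubgroup {G : Subgroup (AutT (n + 2))} {h : AutT (n + 2)} (hh : h ∈ G)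
    (c : Words n × Fin 3 → Words n × Fin 3)
    (hc : ∀ w i, act h (w.1 ++ [i]) = (c (w, i)).1.1 ++ [(c (w, i)).2]) :
    ∃ p : Words n × Fin 3 → Equiv.Perm (Fin 3), ∀ s ∈ leafSubgroup G,
      (fun v => (p v)⁻¹ * s (c v) * p v) ∈ leafSubgroup G := by
  obtain ⟨p, hp⟩ := exists_act_append h
  refine ⟨fun v => p (v.1.1 ++ [v.2]), ?_⟩
  rintro s ⟨g, hg, hgs⟩
  refine ⟨h⁻¹ * g * h, G.mul_mem (G.mul_mem (G.inv_mem hh) hg) hh, fun w i k => ?_⟩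
  have hl : (w.1 ++ [i]).length ≤ n + 1 := by simp [w.2]
  apply act_injective h
  rw [act_mul, act_mul, act_act_inv, hp _ hl, hp _ hl, hc, hgs]
  simp

theorem generate_perm_three : ∀ x y z : Equiv.Perm (Fin 3), x ≠ 1 → x ^ 2 = 1 → y ≠ 1 →
    y ^ 3 = 1 → z = 1 ∨ z = y ∨ z = y * y ∨ z = x ∨ z = x * y ∨ z = x * (y * y) := by
  decide

theorem sign_of_pow_two_eq_one : ∀ x : Equiv.Perm (Fin 3), x ^ 2 = 1 → x ≠ 1 → sign x = -1 := by
  decide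

theorem sign_of_pow_three_eq_one : ∀ x : Equiv.Perm (Fin 3), x ^ 3 = 1 → sign x = 1 := by
  decide

/-- A compatible family of subgroups of the groups `E_n` is the whole family if for every `n` there
are elements of order two and three that act only on the vertices of the highest level. -/
theorem eq_E_of_exists_pow_eq_one (G : ∀ n, Subgroup (AutT n)) (hle : ∀ n, G n ≤ E n)
    (hres : ∀ n, G n ≤ (G (n + 1)).map res)
    (h2 : ∀ n, ∃ g ∈ G (n + 1), res g = 1 ∧ g ≠ 1 ∧ g ^ 2 = 1)
    (h3 : ∀ n, ∃ g ∈ G (n + 1), res g = 1 ∧ g ≠ 1 ∧ g ^ 3 = 1) : ∀ n, G n = E n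
  | 0 => by
    refine le_antisymm (hle 0) fun g _ => ?_
    have : g = 1 := ext_act_of_length_eq fun l hl => by
      rw [List.length_eq_zero_iff] at hl
      rw [hl, act_nil, act_nil]
    rw [this]
    exact (G 0).one_mem
  | 1 => by
    refine le_antisymm (hle 1) fun g _ => ?_
    have hext : ∀ {g h : AutT 1} {β γ : Equiv.Perm (Fin 3)}, (∀ j, act g [j] = [β j]) →
        (∀ j, act h [j] = [γ j]) → β = γ → g = h := by
      intro g h β γ hg hh hβγ
      refine ext_act_of_length_eq fun l hl => ?_
      obtain ⟨j, rfl⟩ := List.length_eq_one_iff.mp hl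
      rw [hg, hh, hβγ]
    have hmul : ∀ {g h : AutT 1} {β γ : Equiv.Perm (Fin 3)}, (∀ j, act g [j] = [β j]) →
        (∀ j, act h [j] = [γ j]) → ∀ j, act (g * h) [j] = [(β * γ) j] := by
      intro g h β γ hg hh j
      rw [act_mul, hh, hg]
      rfl
    have h1 : ∀ j, act (1 : AutT 1) [j] = [(1 : Equiv.Perm (Fin 3)) j] := fun j => act_one _
    have heq : ∀ {g : AutT 1} {β γ : Equiv.Perm (Fin 3)}, (∀ j, act g [j] = [β j]) →
        (∀ j, act g [j] = [γ j]) → β = γ := by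
      intro g β γ hβ hγ
      ext1 j
      simpa using (hβ j).symm.trans (hγ j)
    obtain ⟨x, hx, -, hx1, hx2⟩ := h2 0
    obtain ⟨y, hy, -, hy1, hy3⟩ := h3 0
    obtain ⟨α, hα⟩ := exists_act_singleton x
    obtain ⟨β, hβ⟩ := exists_act_singleton y
    obtain ⟨γ, hγ⟩ := exists_act_singleton g
    have hα2 : α ^ 2 = 1 := heq (g := x ^ 2) (by
      simpa only [pow_two] using hmul hα hα) (by rw [hx2]; exact h1)
    have hβ3 : β ^ 3 = 1 := heq (g := y ^ 3) (by
      simpa only [pow_succ, pow_zero, one_mul] using hmul (hmul hβ hβ) hβ) (by rw [hy3]; exact h1)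
    -- An element of order two and one of order three generate `S₃`.
    rcases generate_perm_three α β γ (fun h => hx1 (hext hα h1 h)) hα2
      (fun h => hy1 (hext hβ h1 h)) hβ3 with h | h | h | h | h | h
    · rw [hext hγ h1 h]
      exact (G 1).one_mem
    · rw [hext hγ hβ h]
      exact hy
    · rw [hext hγ (hmul hβ hβ) h]
      exact (G 1).mul_mem hy hy
    · rw [hext hγ hα h]
      exact hx
    · rw [hext hγ (hmul hα hβ) h]
      exact (G 1).mul_mem hx hy
    · rw [hext hγ (hmul hα (hmul hβ hβ)) h]
      exact (G 1).mul_mem hx ((G 1).mul_mem hy hy)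
  | n + 2 => by
    have ih := eq_E_of_exists_pow_eq_one G hle hres h2 h3 (n + 1)
    have hlift : ∀ a ∈ E (n + 1), ∃ g ∈ G (n + 2), res g = a := by
      intro a ha
      rw [← ih] at ha
      exact hres (n + 1) ha
    have hleaf : ∀ k, (∃ g ∈ G (n + 2), res g = 1 ∧ g ≠ 1 ∧ g ^ k = 1) →
        ∃ s ∈ leafSubgroup (G (n + 2)), s ≠ 1 ∧ ∀ v, s v ^ k = 1 := by
      rintro k ⟨g, hg, hg1, hne, hk⟩
      obtain ⟨s, hs⟩ := exists_isLeaf hg1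
      refine ⟨s, ⟨g, hg, hs⟩, ?_, fun v => ?_⟩
      · rintro rfl
        exact hne (hs.ext isLeaf_one)
      · have := hs.pow k
        rw [hk] at this
        exact congrFun (this.eq isLeaf_one) v
    refine le_antisymm (hle _) fun g hg => ?_
    -- By induction `G` already surjects onto `E (n + 1)`, so `g` may be corrected by an element of
    -- `G` until it acts only on the highest level.
    obtain ⟨h, hh, hhg⟩ := hlift _ (res_mem_E hg)
    have hx : h⁻¹ * g ∈ E (n + 2) := (E (n + 2)).mul_mem ((E (n + 2)).inv_mem (hle _ hh)) hg
    obtain ⟨s, hs⟩ := exists_isLeaf (g := h⁻¹ * g) (by rw [map_mul, map_inv, hhg, inv_mul_cancel])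
    suffices hsW : s ∈ leafSubgroup (G (n + 2)) by
      obtain ⟨x, hxG, hxs⟩ := hsW
      have : g = h * x := by rw [hxs.ext hs, mul_inv_cancel_left]
      rw [this]
      exact (G (n + 2)).mul_mem hh hxG
    refine mem_of_prod_sign_eq_one _ ?_ ?_ ?_ ?_ ?_ s (hs.prod_sign_eq_one hx)
    · rintro s ⟨g, hg, hgs⟩ j
      exact hgs.prod_sign_eq_one (hle _ hg) j
    · intro j
      obtain ⟨a, ha, haj⟩ := exists_mem_E_rotation n j.1 j.2
      obtain ⟨h, hh, rfl⟩ := hlift a ha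
      refine exists_conj_mem_leafSubgroup hh _ fun w i => ?_
      rw [← act_res h (by simp [w.2]), haj _ _ w.2]
      by_cases hw : w = j
      · simp [hw]
      · simp [hw, Subtype.val_injective.eq_iff]
    · rintro ⟨w, i⟩ ⟨w', i'⟩
      obtain ⟨a, ha, haw⟩ := exists_mem_E_act_eq (n + 1) (w.1 ++ [i]) (w'.1 ++ [i'])
        (by simp [w.2]) (by simp [w'.2])
      obtain ⟨h, hh, rfl⟩ := hlift a ha
      rw [act_res h (by simp [w.2])] at haw
      have hex : ∀ v : Words n × Fin 3, ∃ u : Words n × Fin 3,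
          act h (v.1.1 ++ [v.2]) = u.1.1 ++ [u.2] := by
        intro v
        obtain ⟨u, j, hu⟩ := exists_words_eq (n := n) (v := act h (v.1.1 ++ [v.2]))
          (by simp [v.1.2])
        exact ⟨(u, j), hu⟩
      choose c hc using hex
      refine ⟨c, fun v u hvu => ?_, ?_, exists_conj_mem_leafSubgroup hh c fun w i => hc (w, i)⟩
      · have h1 := hc v
        rw [hvu, ← hc u] at h1
        have h2 := List.append_inj' (act_injective h h1) rfl
        exact Prod.ext (Subtype.ext h2.1) (by simpa using h2.2)
      · have h1 := (hc (w, i)).symm.trans haw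
        have h2 := List.append_inj' h1 rfl
        exact Prod.ext (Subtype.ext h2.1) (by simpa using h2.2)
    · obtain ⟨s, hs, hne, h⟩ := hleaf 2 (h2 (n + 1))
      obtain ⟨v, hv⟩ := Function.ne_iff.mp hne
      exact ⟨s, hs, v, sign_of_pow_two_eq_one _ (h v) hv⟩
    · obtain ⟨s, hs, hne, h⟩ := hleaf 3 (h3 (n + 1))
      exact ⟨s, hs, hne, fun v => sign_of_pow_three_eq_one _ (h v)⟩

end Generation

/-! ### The fibres of `f` -/

section Fibre

variable {F : Type*} [Field F]

theorem eval_f (z : F) : (f F).eval z = -2 * z ^ 3 + 3 * z ^ 2 := by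
  simp [f]

/-- The expression is the quotient of `f(a) - f(b)` by `a - b`. It yields the Vieta relations from
distinctness of the preimages alone. -/
theorem fibre_cofactor_eq_zero {a b : F} (hab : a ≠ b) (h : (f F).eval a = (f F).eval b) :
    -2 * (a ^ 2 + a * b + b ^ 2) + 3 * (a + b) = 0 := by
  rw [eval_f, eval_f] at h
  apply mul_left_cancel₀ (sub_ne_zero.mpr hab)
  linear_combination h

theorem fibre_sum {o : Fin 3 → F} {y : F} (ho : Function.Injective o)
    (hf : ∀ i, (f F).eval (o i) = y) : 2 * (o 0 + o 1 + o 2) = 3 := by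
  have h1 := fibre_cofactor_eq_zero (ho.ne (by decide : (0 : Fin 3) ≠ 1)) ((hf 0).trans (hf 1).symm)
  have h2 := fibre_cofactor_eq_zero (ho.ne (by decide : (0 : Fin 3) ≠ 2)) ((hf 0).trans (hf 2).symm)
  have h3 := sub_ne_zero.mpr (ho.ne (by decide : (1 : Fin 3) ≠ 2))
  apply mul_left_cancel₀ h3
  linear_combination h2 - h1

theorem fibre_sum_mul [CharZero F] {o : Fin 3 → F} {y : F} (ho : Function.Injective o)
    (hf : ∀ i, (f F).eval (o i) = y) : o 0 * o 1 + o 0 * o 2 + o 1 * o 2 = 0 := by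
  have h1 := fibre_cofactor_eq_zero (ho.ne (by decide : (0 : Fin 3) ≠ 1)) ((hf 0).trans (hf 1).symm)
  have h4 := fibre_sum ho hf
  apply mul_left_cancel₀ (two_ne_zero (α := F))
  linear_combination (o 0 + o 1) * h4 + h1

theorem fibre_prod [CharZero F] {o : Fin 3 → F} {y : F} (ho : Function.Injective o)
    (hf : ∀ i, (f F).eval (o i) = y) : 2 * (o 0 * o 1 * o 2) = -y := by
  have h1 := fibre_sum ho hf
  have h2 := fibre_sum_mul ho hf
  have h3 := hf 0
  rw [eval_f] at h3
  linear_combination 2 * o 0 * h2 - o 0 ^ 2 * h1 - h3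

theorem eq_of_eval_f_eq [CharZero F] {o : Fin 3 → F} {y : F} (ho : Function.Injective o)
    (hf : ∀ i, (f F).eval (o i) = y) {z : F} (hz : (f F).eval z = y) : ∃ i, z = o i := by
  have h1 := fibre_sum ho hf
  have h2 := fibre_sum_mul ho hf
  have h3 := fibre_prod ho hf
  rw [eval_f] at hz
  have h4 : (z - o 0) * ((z - o 1) * (z - o 2)) = 0 := by
    apply mul_left_cancel₀ (two_ne_zero (α := F))
    linear_combination (-1 : F) * hz - z ^ 2 * h1 + 2 * z * h2 - h3
  rcases mul_eq_zero.mp h4 with h | h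
  · exact ⟨0, sub_eq_zero.mp h⟩
  rcases mul_eq_zero.mp h with h | h
  · exact ⟨1, sub_eq_zero.mp h⟩
  · exact ⟨2, sub_eq_zero.mp h⟩

/-- The Vandermonde product of a triple. -/
def vander (o : Fin 3 → F) : F := (o 0 - o 1) * (o 0 - o 2) * (o 1 - o 2)

theorem vander_comp_perm (o : Fin 3 → F) (β : Equiv.Perm (Fin 3)) :
    vander (fun i => o (β i)) = ((Equiv.Perm.sign β : ℤˣ) : ℤ) * vander o := by
  have key : ∀ β : Equiv.Perm (Fin 3),
      (β 0 = 0 ∧ β 1 = 1 ∧ β 2 = 2 ∧ Equiv.Perm.sign β = 1) ∨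
      (β 0 = 1 ∧ β 1 = 2 ∧ β 2 = 0 ∧ Equiv.Perm.sign β = 1) ∨
      (β 0 = 2 ∧ β 1 = 0 ∧ β 2 = 1 ∧ Equiv.Perm.sign β = 1) ∨
      (β 0 = 1 ∧ β 1 = 0 ∧ β 2 = 2 ∧ Equiv.Perm.sign β = -1) ∨
      (β 0 = 0 ∧ β 1 = 2 ∧ β 2 = 1 ∧ Equiv.Perm.sign β = -1) ∨
      (β 0 = 2 ∧ β 1 = 1 ∧ β 2 = 0 ∧ Equiv.Perm.sign β = -1) := by decide
  unfold vander
  rcases key β with ⟨h0, h1, h2, hs⟩ | ⟨h0, h1, h2, hs⟩ | ⟨h0, h1, h2, hs⟩ | ⟨h0, h1, h2, hs⟩ |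
    ⟨h0, h1, h2, hs⟩ | ⟨h0, h1, h2, hs⟩ <;> simp only [h0, h1, h2, hs] <;> push_cast <;> ring

theorem vander_ne_zero {o : Fin 3 → F} (ho : Function.Injective o) : vander o ≠ 0 := by
  refine mul_ne_zero (mul_ne_zero ?_ ?_) ?_ <;> exact sub_ne_zero.mpr (ho.ne (by decide))

theorem injective_of_ne {α : Type*} {o : Fin 3 → α} (h01 : o 0 ≠ o 1) (h02 : o 0 ≠ o 2)
    (h12 : o 1 ≠ o 2) : Function.Injective o := by
  intro i j hij
  fin_cases i <;> fin_cases j <;> simp_all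

theorem injective_of_vander_ne_zero {o : Fin 3 → F} (h : vander o ≠ 0) : Function.Injective o := by
  have h1 := mul_ne_zero_iff.mp h
  have h2 := mul_ne_zero_iff.mp h1.1
  exact injective_of_ne (sub_ne_zero.mp h2.1) (sub_ne_zero.mp h2.2) (sub_ne_zero.mp h1.2)

/-- This is the discriminant of `f(z) - y`, with the elementary symmetric functions `3/2`, `0` and
`-y/2` inserted. The assumptions are the Vieta relations rather than injectivity of `o`, so that
`exists_fibre` can deduce injectivity from it. -/
theorem vander_sq_of_eq {o : Fin 3 → F} {y : F} (h1 : 2 * (o 0 + o 1 + o 2) = 3)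
    (h2 : o 0 * o 1 + o 0 * o 2 + o 1 * o 2 = 0) (h3 : 2 * (o 0 * o 1 * o 2) = -y) :
    4 * vander o ^ 2 = 27 * (y * (1 - y)) := by
  obtain rfl : y = -(2 * (o 0 * o 1 * o 2)) := by linear_combination h3
  have key : ∀ a b c : F, 4 * ((a - b) * (a - c) * (b - c)) ^ 2 =
      4 * ((a + b + c) ^ 2 * (a * b + a * c + b * c) ^ 2 - 4 * (a * b + a * c + b * c) ^ 3
        - 4 * (a + b + c) ^ 3 * (a * b * c)
        + 18 * (a + b + c) * (a * b + a * c + b * c) * (a * b * c) - 27 * (a * b * c) ^ 2) := by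
    intro a b c
    ring
  rw [vander, key, h2]
  linear_combination (-2 * (o 0 * o 1 * o 2)) *
    ((2 * (o 0 + o 1 + o 2)) ^ 2 + 3 * (2 * (o 0 + o 1 + o 2)) + 9) * h1

theorem vander_sq [CharZero F] {o : Fin 3 → F} {y : F} (ho : Function.Injective o)
    (hf : ∀ i, (f F).eval (o i) = y) : 4 * vander o ^ 2 = 27 * (y * (1 - y)) :=
  vander_sq_of_eq (fibre_sum ho hf) (fibre_sum_mul ho hf) (fibre_prod ho hf)

theorem exists_fibre [CharZero F] [IsAlgClosed F] {y : F} (h0 : y ≠ 0) (h1 : y ≠ 1) :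
    ∃ o : Fin 3 → F, Function.Injective o ∧ ∀ i, (f F).eval (o i) = y := by
  have hdeg : (f F - C y).degree ≠ 0 := by
    intro h
    have := natDegree_eq_of_degree_eq_some h
    rw [natDegree_sub_C, natDegree_f] at this
    exact absurd this (by decide)
  obtain ⟨a, ha⟩ := IsAlgClosed.exists_root _ hdeg
  simp only [IsRoot.def, eval_sub, eval_C, sub_eq_zero] at ha
  rw [eval_f] at ha
  -- After one root `a`, the other two have sum `3/2 - a` and product `a² - 3a/2`; `b` is a square
  -- root of the discriminant of their quadratic.
  obtain ⟨b, hb⟩ := IsAlgClosed.exists_eq_mul_self ((a - 3 / 2) ^ 2 - 4 * (a ^ 2 - 3 / 2 * a))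
  let o : Fin 3 → F := ![a, (3 / 2 - a + b) / 2, (3 / 2 - a - b) / 2]
  have e1 : 2 * (o 0 + o 1 + o 2) = 3 := by
    simp [o]
    ring
  have e2 : o 0 * o 1 + o 0 * o 2 + o 1 * o 2 = 0 := by
    simp [o]
    linear_combination (1 / 4 : F) * hb
  have e3 : 2 * (o 0 * o 1 * o 2) = -y := by
    simp [o]
    linear_combination (-1 : F) * ha + a / 2 * hb
  refine ⟨o, injective_of_vander_ne_zero fun h => ?_, fun i => ?_⟩
  · have h2 := vander_sq_of_eq e1 e2 e3
    rw [h] at h2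
    have h3 : (27 : F) ≠ 0 := by norm_num
    refine mul_ne_zero h3 (mul_ne_zero h0 (sub_ne_zero.mpr h1.symm)) ?_
    rw [← h2]
    ring
  · have h3 : (o i - o 0) * (o i - o 1) * (o i - o 2) = 0 := by
      fin_cases i <;> simp
    rw [eval_f]
    linear_combination -2 * h3 - o i ^ 2 * e1 + 2 * o i * e2 - e3

end Fibre

/-! ### Labellings of preimage trees -/

section Labelling

variable (Ω : Type*) [Field Ω]

/-- An element `y` of `Ω` with an enumeration of its three preimages under `f`. -/
structure Node where
  /-- the element -/
  y : Ω
  /-- its preimages -/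
  o : Fin 3 → Ω
  inj : Function.Injective o
  eval_o : ∀ i, (f Ω).eval (o i) = y
  ne_zero : y ≠ 0
  ne_one : y ≠ 1

variable {Ω} [CharZero Ω] [IsAlgClosed Ω]

theorem exists_node {y : Ω} (h0 : y ≠ 0) (h1 : y ≠ 1) : ∃ s : Node Ω, s.y = y := by
  obtain ⟨o, ho, hf⟩ := exists_fibre h0 h1
  exact ⟨⟨y, o, ho, hf, h0, h1⟩, rfl⟩

/-- The preimages of a node can be enumerated such that the product of their Vandermonde products is
the Vandermonde product of the node, up to a constant. -/
theorem exists_next (s : Node Ω) : ∃ next : Fin 3 → Node Ω, (∀ i, (next i).y = s.o i) ∧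
    8 * ∏ i, vander (next i).o = 27 * vander s.o := by
  have h0 : ∀ i, s.o i ≠ 0 := fun i h => s.ne_zero (by rw [← s.eval_o i, h, eval_f]; ring)
  have h1 : ∀ i, s.o i ≠ 1 := fun i h => s.ne_one (by rw [← s.eval_o i, h, eval_f]; ring)
  choose next hnext using fun i => exists_node (h0 i) (h1 i)
  have hsq : ∀ i, 4 * vander (next i).o ^ 2 = 27 * (s.o i * (1 - s.o i)) := by
    intro i
    rw [vander_sq (next i).inj (next i).eval_o, hnext]
  have e0 := vander_sq s.inj s.eval_o
  have e1 := fibre_sum s.inj s.eval_o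
  have e2 := fibre_sum_mul s.inj s.eval_o
  have e3 := fibre_prod s.inj s.eval_o
  -- The product of the `oᵢ` is `-y/2` and, by the symmetry `f(1 - z) = 1 - f(z)`, that of the `1 -
  -- oᵢ` is `-(1 - y)/2`.
  have hprod : 4 * ((s.o 0 * s.o 1 * s.o 2) * ((1 - s.o 0) * (1 - s.o 1) * (1 - s.o 2))) =
      s.y * (1 - s.y) := by
    have h : 2 * ((1 - s.o 0) * (1 - s.o 1) * (1 - s.o 2)) = -(1 - s.y) := by
      linear_combination -e1 + 2 * e2 - e3
    linear_combination e3 * (2 * ((1 - s.o 0) * (1 - s.o 1) * (1 - s.o 2))) - s.y * h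
  have hsquare : (8 * ∏ i, vander (next i).o) ^ 2 = (27 * vander s.o) ^ 2 := by
    rw [Fin.prod_univ_three]
    have a0 := hsq 0
    have a1 := hsq 1
    have a2 := hsq 2
    calc (8 * (vander (next 0).o * vander (next 1).o * vander (next 2).o)) ^ 2
        = (4 * vander (next 0).o ^ 2) * (4 * vander (next 1).o ^ 2) *
          (4 * vander (next 2).o ^ 2) := by ring
      _ = 27 ^ 2 * (4 * vander s.o ^ 2) / 4 := by
        rw [a0, a1, a2, e0]
        linear_combination (27 ^ 3 / 4 : Ω) * hprod
      _ = _ := by ring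
  rcases sq_eq_sq_iff_eq_or_eq_neg.mp hsquare with h | h
  · exact ⟨next, hnext, h⟩
  -- If the sign is wrong, a transposition in the enumeration above one of the three elements
  -- corrects it.
  · let c : Equiv.Perm (Fin 3) := Equiv.swap 0 1
    let s' : Node Ω := ⟨(next 0).y, fun i => (next 0).o (c i), (next 0).inj.comp c.injective,
      fun i => (next 0).eval_o _, (next 0).ne_zero, (next 0).ne_one⟩
    have hs' : vander s'.o = -vander (next 0).o := by
      rw [vander_comp_perm, Equiv.Perm.sign_swap (by decide)]
      simp
    refine ⟨![s', next 1, next 2], fun i => ?_, ?_⟩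
    · fin_cases i
      exacts [hnext 0, hnext 1, hnext 2]
    · rw [Fin.prod_univ_three] at h ⊢
      simp only [Matrix.cons_val_zero, Matrix.cons_val_one, Matrix.cons_val, hs']
      linear_combination -h

/-- Compatibly enumerated preimages of the elements of the fibre of a node. -/
def Node.next (s : Node Ω) : Fin 3 → Node Ω := (exists_next s).choose

theorem Node.next_y (s : Node Ω) (i : Fin 3) : (s.next i).y = s.o i :=
  (exists_next s).choose_spec.1 i

theorem Node.prod_vander_next (s : Node Ω) : 8 * ∏ i, vander (s.next i).o = 27 * vander s.o :=
  (exists_next s).choose_spec.2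

/-- The labelling of the tree of iterated preimages of `s` by words. -/
def lab : Node Ω → List (Fin 3) → Ω
  | s, [] => s.y
  | s, i :: w => lab (s.next i) w

theorem lab_singleton (s : Node Ω) (i : Fin 3) : lab s [i] = s.o i := s.next_y i

theorem eval_lab_append (s : Node Ω) (w : List (Fin 3)) (i : Fin 3) :
    (f Ω).eval (lab s (w ++ [i])) = lab s w := by
  induction w generalizing s with
  | nil => exact (congrArg (fun z => (f Ω).eval z) (lab_singleton s i)).trans (s.eval_o i)
  | cons j w ih => exact ih (s.next j)

theorem iterate_lab (s : Node Ω) (w : List (Fin 3)) :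
    (fun z => (f Ω).eval z)^[w.length] (lab s w) = s.y := by
  induction w using List.reverseRecOn with
  | nil => rfl
  | append_singleton w i ih =>
    rw [List.length_append, List.length_singleton, Function.iterate_succ_apply]
    simp only [eval_lab_append]
    exact ih

theorem lab_injective (s : Node Ω) : ∀ v w : List (Fin 3), v.length = w.length →
    lab s v = lab s w → v = w := by
  intro v
  induction v generalizing s with
  | nil =>
    intro w hw _
    exact (List.length_eq_zero_iff.mp hw.symm).symm
  | cons i v ih =>
    intro w hw h
    obtain ⟨j, w, rfl⟩ := List.exists_cons_of_length_eq_add_one hw.symm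
    have hw' : v.length = w.length := by simpa using hw
    have h1 := iterate_lab (s.next i) v
    have h2 := iterate_lab (s.next j) w
    change lab (s.next i) v = lab (s.next j) w at h
    rw [h, hw', h2, s.next_y, s.next_y] at h1
    obtain rfl := s.inj h1
    rw [ih _ w hw' h]

theorem exists_lab_eq (s : Node Ω) (m : ℕ) {z : Ω} (hz : (fun z => (f Ω).eval z)^[m] z = s.y) :
    ∃ w, w.length = m ∧ lab s w = z := by
  induction m generalizing s with
  | zero => exact ⟨[], rfl, hz.symm⟩
  | succ m ih =>
    rw [Function.iterate_succ_apply'] at hz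
    obtain ⟨i, hi⟩ := eq_of_eval_f_eq s.inj s.eval_o hz
    obtain ⟨w, hw, h⟩ := ih (s.next i) (hi.trans (s.next_y i).symm)
    exact ⟨i :: w, by rw [List.length_cons, hw], h⟩

/-- Let `x` and `σ x` be the images of an element under two homomorphisms `ι` and `ισ` of a field to
`Ω`. If `σ` maps the root of a preimage tree to the root of another one, then it acts by an element
of `E_n`. -/
theorem exists_mem_E_lab {N : Type*} [Field N] (ι ισ : N →+* Ω) :
    ∀ (n : ℕ) (s s' : Node Ω), (∀ w : List (Fin 3), w.length ≤ n → lab s w ∈ ι.range) →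
      (∀ x, ι x = s.y → ισ x = s'.y) →
      ∃ a ∈ E n, ∀ w : List (Fin 3), w.length ≤ n → ∀ x, ι x = lab s w → ισ x = lab s' (act a w)
  | 0, s, s', _, hy => by
    refine ⟨1, (E 0).one_mem, fun w hw x hx => ?_⟩
    obtain rfl := List.length_eq_zero_iff.mp (Nat.le_zero.mp hw)
    rw [act_nil]
    exact hy x hx
  | n + 1, s, s', hw, hy => by
    have hrange : ∀ i, ∃ x, ι x = s.o i := fun i => by
      obtain ⟨x, hx⟩ := hw [i] (by simp)
      exact ⟨x, hx.trans (lab_singleton s i)⟩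
    choose x hx using hrange
    have heval : ∀ (τ : N →+* Ω) z, τ ((f N).eval z) = (f Ω).eval (τ z) := by
      intro τ z
      rw [← map_f τ, eval_map, eval₂_hom]
    have hb : ∀ i, ∃ j, ισ (x i) = s'.o j := by
      intro i
      refine eq_of_eval_f_eq s'.inj s'.eval_o ?_
      rw [← heval]
      refine hy _ ?_
      rw [heval, hx, s.eval_o]
    choose b hb using hb
    have hbinj : Function.Injective b := by
      intro i j hij
      have : ισ (x i) = ισ (x j) := by rw [hb, hb, hij]
      refine s.inj ?_
      rw [← hx, ← hx, ισ.injective this]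
    let β : Equiv.Perm (Fin 3) := Equiv.ofBijective b (Finite.injective_iff_bijective.mp hbinj)
    have hβ : ∀ i, ισ (x i) = s'.o (β i) := hb
    -- The subtree above `i` is carried to the one above `β i`, in general a different tree; this is
    -- why the induction involves two nodes.
    choose a haE ha using fun i => exists_mem_E_lab ι ισ n (s.next i) (s'.next (β i))
      (fun w hwn => hw (i :: w) (by simpa using hwn))
      (fun z hz => by
        have : z = x i := ι.injective (by rw [hz, hx, s.next_y])
        rw [this, hβ, s'.next_y])
    obtain ⟨g, hg⟩ := exists_isWreath a β
    have hgw : ∀ w : List (Fin 3), w.length ≤ n + 1 → ∀ x, ι x = lab s w →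
        ισ x = lab s' (act g w) := by
      rintro (_ | ⟨i, w⟩) hwn z hz
      · rw [act_nil]
        exact hy z hz
      · have hwn' : w.length ≤ n := by simpa using hwn
        rw [hg i w hwn']
        exact ha i w hwn' z hz
    rcases n with _ | n
    · exact ⟨g, Subgroup.mem_top _, hgw⟩
    · refine ⟨g, hg.mem_E haE ?_, hgw⟩
      have hvander : ∀ (τ : N →+* Ω) (u : Fin 3 → N), τ (vander u) = vander fun i => τ (u i) := by
        intro τ u
        simp [vander]
      choose u hu using fun i j => show ∃ u, ι u = (s.next i).o j by
        obtain ⟨u, hu⟩ := hw [i, j] (by simp)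
        exact ⟨u, hu.trans (lab_singleton (s.next i) j)⟩
      have h1 : ∀ i, ισ (vander (u i)) =
          ((sgn (n + 1) 1 (a i) : ℤˣ) : ℤ) * vander (s'.next (β i)).o := by
        intro i
        obtain ⟨γ, hγ⟩ := exists_act_singleton (a i)
        rw [hvander, sgn_one_eq hγ, ← vander_comp_perm]
        congr 1
        funext j
        rw [ha i [j] (by simp) (u i j) ((hu i j).trans (lab_singleton _ _).symm), hγ, lab_singleton]
      have h2 : ισ (vander x) = ((Equiv.Perm.sign β : ℤˣ) : ℤ) * vander s'.o := by
        rw [hvander, ← vander_comp_perm]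
        congr 1
        funext i
        exact hβ i
      have h3 : 8 * ∏ i, vander (u i) = 27 * vander x := by
        apply ι.injective
        have := s.prod_vander_next
        simp only [map_mul, map_prod, hvander, hu, hx, map_ofNat]
        exact this
      -- Applying `ισ` multiplies one side of the relation by the signs of the `a i`, the other by
      -- the sign of `β`. The same relation holds at `s'`, so these signs agree.
      have h4 := congrArg ισ h3
      simp only [map_mul, map_prod, map_ofNat, h1, h2] at h4
      rw [Finset.prod_mul_distrib, Equiv.prod_comp β fun i => vander (s'.next i).o,
        mul_left_comm, s'.prod_vander_next, mul_left_comm (27 : Ω)] at h4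
      have h5 := mul_right_cancel₀ (mul_ne_zero (by norm_num) (vander_ne_zero s'.inj)) h4
      have h6 : ∏ i, sgn (n + 1) 1 (a i) = Equiv.Perm.sign β := by
        apply Units.ext
        exact_mod_cast h5
      rw [h6]
      exact Int.units_mul_self _

end Labelling

/-! ### Automorphisms of splitting fields that are induced by endomorphisms -/

section Restriction

variable {K M F : Type*} [Field K] [Field M] [Field F] [Algebra K M]

theorem exists_restrict_of_embedding [Normal K M] (ι : M →+* F) (θ : F →+* F)
    (hθ : ∀ x : K, θ (ι (algebraMap K M x)) = ι (algebraMap K M x)) :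
    ∃ σ : Gal(M/K), ∀ m, ι (σ m) = θ (ι m) := by
  let _ : Algebra K F := (ι.comp (algebraMap K M)).toAlgebra
  let _ : Algebra M F := ι.toAlgebra
  have : IsScalarTower K M F := IsScalarTower.of_algebraMap_eq fun _ => rfl
  let Θ : F →ₐ[K] F := { θ with commutes' := hθ }
  exact ⟨Θ.restrictNormal' M, fun m => Θ.restrictNormal_commutes M m⟩

/-- The splitting field embeds into `F`, and its image is stable under `θ` by normality; no
surjectivity of `θ` is required. -/
theorem exists_restrict (P : K[X]) [IsSplittingField K M P] (ψ : K →+* F) (hP : (P.map ψ).Splits)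
    (θ : F →+* F) (hθ : ∀ x, θ (ψ x) = ψ x) :
    ∃ (ι : M →+* F) (σ : Gal(M/K)), (∀ x, ι (algebraMap K M x) = ψ x) ∧
      ∀ m, ι (σ m) = θ (ι m) := by
  let _ : Algebra K F := ψ.toAlgebra
  let ι : M →ₐ[K] F := IsSplittingField.lift M P hP
  have : Normal K M := Normal.of_isSplittingField P
  obtain ⟨σ, hσ⟩ := exists_restrict_of_embedding (K := K) ι.toRingHom θ
    (fun x => by
      change θ (ι (algebraMap K M x)) = ι (algebraMap K M x)
      rw [ι.commutes]
      exact hθ x)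
  exact ⟨ι, σ, ι.commutes, hσ⟩

theorem exists_lift {N : Type*} [Field N] [Algebra K N] [Normal K N] (i : M →ₐ[K] N)
    (σ : Gal(M/K)) : ∃ τ : Gal(N/K), ∀ m, τ (i m) = i (σ m) := by
  let _ : Algebra M N := i.toRingHom.toAlgebra
  have : IsScalarTower K M N := IsScalarTower.of_algebraMap_eq fun x => (i.commutes x).symm
  exact ⟨σ.liftNormal N, fun m => σ.liftNormal_commutes N m⟩

end Restriction

/-! ### Preimage trees inside a field with an endomorphism `ρ` -/

section Tower

variable {F : Type*} [Field F]

theorem map_eval_f {N : Type*} [Field N] (τ : N →+* F) (z : N) :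
    τ ((f N).eval z) = (f F).eval (τ z) := by
  rw [← map_f τ, eval_map, eval₂_hom]

theorem map_iterate_eval_f {N : Type*} [Field N] (τ : N →+* F) (n : ℕ) (z : N) :
    τ ((fun z => (f N).eval z)^[n] z) = (fun z => (f F).eval z)^[n] (τ z) := by
  induction n generalizing z with
  | zero => rfl
  | succ n ih => rw [Function.iterate_succ_apply, Function.iterate_succ_apply, ih, map_eval_f]

theorem map_comp_iterate {N : Type*} [Field N] (τ : N →+* F) (n : ℕ) :
    ((f N).comp^[n] X).map τ = (f F).comp^[n] X := by
  induction n with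
  | zero => simp
  | succ n ih =>
    rw [Function.iterate_succ_apply', Function.iterate_succ_apply', Polynomial.map_comp, ih, map_f]

theorem iterate_comp_eq (n : ℕ) (q : F[X]) : (f F).comp^[n] q = ((f F).comp^[n] X).comp q := by
  induction n with
  | zero => simp
  | succ n ih =>
    rw [Function.iterate_succ_apply', Function.iterate_succ_apply', ih, comp_assoc]

theorem splits_f_sub_C [CharZero F] {o : Fin 3 → F} {u : F} (ho : Function.Injective o)
    (hf : ∀ i, (f F).eval (o i) = u) : (f F - C u).Splits := by
  have h1 := congrArg C (fibre_sum ho hf)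
  have h2 := congrArg C (fibre_sum_mul ho hf)
  have h3 := congrArg C (fibre_prod ho hf)
  simp only [map_mul, map_add, map_ofNat, map_zero, map_neg] at h1 h2 h3
  have : f F - C u = C (-2) * ∏ i, (X - C (o i)) := by
    rw [Fin.prod_univ_three, f]
    simp only [map_neg, map_ofNat]
    linear_combination -X ^ 2 * h1 + 2 * X * h2 - h3
  rw [this]
  exact (Splits.prod fun i _ => Splits.X_sub_C _).C_mul _

theorem Splits.comp_of_roots {P Q : F[X]} (hP : P.Splits)
    (h : ∀ r ∈ P.roots, (Q - C r).Splits) : (P.comp Q).Splits := by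
  rw [hP.eq_prod_roots, mul_comp, C_comp, multiset_prod_comp]
  refine (Splits.multisetProd fun g hg => ?_).C_mul _
  simp only [Multiset.map_map, Multiset.mem_map, Function.comp_apply] at hg
  obtain ⟨r, hr, rfl⟩ := hg
  simpa using h r hr

theorem isRoot_iterate_sub_C (n : ℕ) (u z : F) :
    ((f F).comp^[n] X - C u).IsRoot z ↔ (fun z => (f F).eval z)^[n] z = u := by
  rw [IsRoot.def, eval_sub, eval_C, sub_eq_zero, ← aeval_iterate (K := F), coe_aeval_eq_eval]

variable [CharZero F]

theorem iterate_sub_C_ne_zero (n : ℕ) (u : F) : (f F).comp^[n] X - C u ≠ 0 := by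
  intro h
  have := congrArg natDegree h
  rw [natDegree_sub_C, natDegree_iterate, natDegree_zero] at this
  exact absurd this (by positivity)

variable {ρ : F →+* F} {A : Set F} {T : F}

/-- If the fibre of `f` above `ρ y` is contained in `A` for all `y ∈ A`, then `fⁿ` has only
preimages in `A` above `ρⁿ T` for `T ∈ A`. -/
theorem splits_iterate_sub_C (hA : ∀ y ∈ A, ∃ o : Fin 3 → F, Function.Injective o ∧
    ∀ i, (f F).eval (o i) = ρ y ∧ o i ∈ A) (hT : T ∈ A) (n : ℕ) :
    ((f F).comp^[n] X - C (ρ^[n] T)).Splits ∧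
      ∀ z, (fun z => (f F).eval z)^[n] z = ρ^[n] T → z ∈ A := by
  induction n with
  | zero =>
    refine ⟨Splits.X_sub_C _, fun z hz => ?_⟩
    obtain rfl : z = T := hz
    exact hT
  | succ n ih =>
    obtain ⟨hs, hroots⟩ := ih
    have hmap : ((f F).comp^[n] X - C (ρ^[n] T)).map ρ =
        (f F).comp^[n] X - C (ρ^[n + 1] T) := by
      rw [Polynomial.map_sub, map_comp_iterate, map_C, Function.iterate_succ_apply']
    -- Since `f` has integer coefficients, `ρ` carries the preimages of `ρⁿ T` under `fⁿ` to those
    -- of `ρⁿ⁺¹ T`; as the polynomial already splits, every one of the latter arises in this way.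
    have hmem : ∀ x, (fun z => (f F).eval z)^[n] x = ρ^[n + 1] T → ∃ y ∈ A, ρ y = x := by
      intro x hx
      rw [← isRoot_iterate_sub_C, ← hmap] at hx
      obtain ⟨y, rfl⟩ := hs.mem_range_of_isRoot (iterate_sub_C_ne_zero _ _) hx
      refine ⟨y, hroots y ?_, rfl⟩
      rw [hmap, isRoot_iterate_sub_C, ← map_iterate_eval_f, Function.iterate_succ_apply'] at hx
      exact ρ.injective hx
    constructor
    · have hcomp : (f F).comp^[n + 1] X - C (ρ^[n + 1] T) =
          ((f F).comp^[n] X - C (ρ^[n + 1] T)).comp (f F) := by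
        rw [sub_comp, C_comp, Function.iterate_succ_apply, comp_X, iterate_comp_eq]
      rw [hcomp]
      refine Splits.comp_of_roots (hmap ▸ hs.map ρ) fun r hr => ?_
      rw [mem_roots (iterate_sub_C_ne_zero _ _), isRoot_iterate_sub_C] at hr
      obtain ⟨y, hy, rfl⟩ := hmem r hr
      obtain ⟨o, ho, hf⟩ := hA y hy
      exact splits_f_sub_C ho fun i => (hf i).1
    · intro z hz
      rw [Function.iterate_succ_apply] at hz
      obtain ⟨y, hy, hyz⟩ := hmem _ hz
      obtain ⟨o, ho, hf⟩ := hA y hy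
      obtain ⟨i, rfl⟩ := eq_of_eval_f_eq ho (fun i => (hf i).1) hyz.symm
      exact (hf i).2

variable {K Ω : Type*} [Field K] [Field Ω] [Algebra K Ω] [CharZero Ω] [IsAlgClosed Ω]

instance isSplittingField_splitField (t : K) (n : ℕ) :
    IsSplittingField K (splitField Ω t n) (arborealPoly t n) :=
  adjoin_rootSet_isSplittingField (IsAlgClosed.splits _)

/-- An abstract form of the inertia argument: `ρ` is `X ↦ X^p` and `θ` is `X ↦ ζX`. The set `A`
ensures that all preimages exist in `F`, while `B` follows one branch of the tree that stays fully
ramified, on which `θ` acts nontrivially. -/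
theorem exists_gal_of_tower (hA : ∀ y ∈ A, ∃ o : Fin 3 → F, Function.Injective o ∧
    ∀ i, (f F).eval (o i) = ρ y ∧ o i ∈ A) (hT : T ∈ A)
    {B : Set F} (hTB : T ∈ B) (hB : ∀ y ∈ B, ∃ z ∈ B, (f F).eval z = ρ y)
    {θ : F →+* F} (hρ : ∀ x, θ (ρ x) = ρ x) (hθB : ∀ z ∈ B, θ z ≠ z) {p : ℕ}
    (hp : ∀ x, θ^[p] x = x) (n : ℕ) {t : K} (ψ : K →+* F) (hψ : ψ t = ρ^[n + 1] T)
    (hθ : ∀ x, θ (ψ x) = ψ x) :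
    ∃ σ : Gal(splitField Ω t (n + 1)/K), σ ^ p = 1 ∧ σ ≠ 1 ∧ ∀ x : splitField Ω t (n + 1),
      (fun z => (f Ω).eval z)^[n] x.1 = algebraMap K Ω t → σ x = x := by
  have hmap : (arborealPoly t (n + 1)).map ψ = (f F).comp^[n + 1] X - C (ρ^[n + 1] T) := by
    rw [arborealPoly, Polynomial.map_sub, map_comp_iterate, map_C, hψ]
  have hs := (splits_iterate_sub_C hA hT (n + 1)).1
  obtain ⟨ι, σ, hι, hσ⟩ := exists_restrict (M := splitField Ω t (n + 1)) (arborealPoly t (n + 1)) ψ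
    (hmap ▸ hs) θ hθ
  refine ⟨σ, ?_, ?_, fun x hx => ?_⟩
  · ext1 x
    apply ι.injective
    have : ∀ k : ℕ, ι ((σ ^ k) x) = θ^[k] (ι x) := by
      intro k
      induction k with
      | zero => rfl
      | succ k ih => rw [pow_succ', AlgEquiv.mul_apply, hσ, ih, Function.iterate_succ_apply']
    rw [this, hp]
    rfl
  -- The branch inside `B` provides a vertex of level `n + 1` that `θ` moves.
  · have hex : ∀ k : ℕ, ∃ z ∈ B, (fun z => (f F).eval z)^[k] z = ρ^[k] T := by
      intro k
      induction k with
      | zero => exact ⟨T, hTB, rfl⟩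
      | succ k ih =>
        obtain ⟨y, hy, hyk⟩ := ih
        obtain ⟨z, hz, hzy⟩ := hB y hy
        refine ⟨z, hz, ?_⟩
        rw [Function.iterate_succ_apply, Function.iterate_succ_apply', hzy, ← map_iterate_eval_f,
          hyk]
    obtain ⟨z, hzB, hz⟩ := hex (n + 1)
    have hsM := IsSplittingField.splits (splitField Ω t (n + 1)) (arborealPoly t (n + 1))
    have hne : (arborealPoly t (n + 1)).map (algebraMap K (splitField Ω t (n + 1))) ≠ 0 := by
      rw [arborealPoly, Polynomial.map_sub, map_comp_iterate, map_C]
      exact iterate_sub_C_ne_zero _ _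
    have hcomp : ι.comp (algebraMap K (splitField Ω t (n + 1))) = ψ := RingHom.ext hι
    obtain ⟨m, rfl⟩ := hsM.mem_range_of_isRoot hne (i := ι) (x := z) (by
      rw [Polynomial.map_map, hcomp, hmap, isRoot_iterate_sub_C, hz])
    rintro rfl
    exact hθB _ hzB (hσ m).symm
  · apply ι.injective
    rw [hσ]
    have hx' : (fun z => (f F).eval z)^[n] (ι x) = ρ^[n + 1] T := by
      rw [← map_iterate_eval_f, ← hψ, ← hι]
      congr 1
      apply (algebraMap (splitField Ω t (n + 1)) Ω).injective
      rw [map_iterate_eval_f]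
      exact hx
    -- The vertices of level `n` lie over `ρⁿ⁺¹ T` under only `n` iterates, hence in the image of
    -- `ρ`, which `θ` fixes pointwise.
    have hm : ((f F).comp^[n] X - C (ρ^[n] T)).map ρ = (f F).comp^[n] X - C (ρ^[n + 1] T) := by
      rw [Polynomial.map_sub, map_comp_iterate, map_C, Function.iterate_succ_apply']
    rw [← isRoot_iterate_sub_C, ← hm] at hx'
    obtain ⟨y, hy⟩ := (splits_iterate_sub_C hA hT n).1.mem_range_of_isRoot
      (iterate_sub_C_ne_zero _ _) hx'
    rw [← hy, hρ]

end Tower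

/-! ### Laurent series -/

section Laurent

variable {Ω : Type*} [Field Ω]

/-- The substitution `X ↦ Xᵖ` of Laurent series. -/
def dilate (p : ℕ) (hp : 0 < p) : HahnSeries ℤ Ω →+* HahnSeries ℤ Ω :=
  HahnSeries.embDomainRingHom (AddMonoidHom.mulLeft (p : ℤ))
    (fun _ _ h => mul_left_cancel₀ (by positivity) h)
    (fun _ _ => mul_le_mul_iff_right₀ (by positivity))

theorem coeff_dilate_mul (p : ℕ) (hp : 0 < p) (x : HahnSeries ℤ Ω) (n : ℤ) :
    (dilate p hp x).coeff (p * n) = x.coeff n :=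
  HahnSeries.embDomain_coeff (f := ⟨⟨fun n => (p : ℤ) * n, _⟩, _⟩) (a := n)

theorem coeff_dilate_of_not_dvd (p : ℕ) (hp : 0 < p) (x : HahnSeries ℤ Ω) (n : ℤ)
    (h : ¬ (p : ℤ) ∣ n) : (dilate p hp x).coeff n = 0 := by
  refine HahnSeries.embDomain_of_notMem_range ?_
  rintro ⟨m, rfl⟩
  exact h (dvd_mul_right _ _)

theorem coeff_dilate_zero (p : ℕ) (hp : 0 < p) (x : HahnSeries ℤ Ω) :
    (dilate p hp x).coeff 0 = x.coeff 0 := by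
  simpa using coeff_dilate_mul p hp x 0

theorem dilate_single (p : ℕ) (hp : 0 < p) (n : ℤ) (a : Ω) :
    dilate p hp (HahnSeries.single n a) = HahnSeries.single (p * n) a :=
  HahnSeries.embDomain_single

/-- The substitution `X ↦ ζ X` of Laurent series. -/
def twist (ζ : Ωˣ) : HahnSeries ℤ Ω →+* HahnSeries ℤ Ω where
  toFun x := ⟨fun n => (ζ ^ n : Ωˣ) * x.coeff n,
    x.isPWO_support.mono fun n hn h => hn (by
      change ((ζ ^ n : Ωˣ) : Ω) * x.coeff n = 0
      rw [h, mul_zero])⟩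
  map_one' := by
    ext n
    by_cases hn : n = 0 <;> simp [HahnSeries.coeff_one, hn]
  map_zero' := by
    ext n
    simp
  map_add' x y := by
    ext n
    simp [mul_add]
  map_mul' x y := by
    ext n
    simp only [HahnSeries.coeff_mul, Finset.mul_sum]
    refine Finset.sum_congr ?_ fun ij hij => ?_
    · have hζ : ∀ k : ℤ, (ζ : Ω) ^ k ≠ 0 := fun k => zpow_ne_zero k ζ.ne_zero
      ext ij
      simp [HahnSeries.mem_support, hζ]
    · have h := hij
      simp only [Finset.mem_antidiagonal] at h
      rw [← h.2.2, zpow_add]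
      push_cast
      ring

theorem coeff_twist (ζ : Ωˣ) (x : HahnSeries ℤ Ω) (n : ℤ) :
    (twist ζ x).coeff n = (ζ ^ n : Ωˣ) * x.coeff n := rfl

theorem twist_C (ζ : Ωˣ) (a : Ω) : twist ζ (HahnSeries.C a) = HahnSeries.C a := by
  ext n
  rw [coeff_twist]
  by_cases hn : n = 0
  · simp [hn]
  · simp [HahnSeries.C_apply, HahnSeries.coeff_single_of_ne hn]

theorem twist_dilate {p : ℕ} (hp : 0 < p) {ζ : Ωˣ} (hζ : ζ ^ p = 1) (x : HahnSeries ℤ Ω) :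
    twist ζ (dilate p hp x) = dilate p hp x := by
  ext n
  rw [coeff_twist]
  by_cases hn : (p : ℤ) ∣ n
  · obtain ⟨m, rfl⟩ := hn
    rw [zpow_mul, zpow_natCast, hζ, one_zpow, Units.val_one, one_mul]
  · rw [coeff_dilate_of_not_dvd p hp x n hn, mul_zero]

theorem iterate_twist {p : ℕ} {ζ : Ωˣ} (hζ : ζ ^ p = 1) (x : HahnSeries ℤ Ω) :
    (twist ζ)^[p] x = x := by
  have key : ∀ k : ℕ, ∀ n, ((twist ζ)^[k] x).coeff n = ((ζ ^ k) ^ n : Ωˣ) * x.coeff n := by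
    intro k n
    induction k with
    | zero => simp
    | succ k ih =>
      rw [Function.iterate_succ_apply', coeff_twist, ih, pow_succ', mul_zpow]
      push_cast
      ring
  ext n
  rw [key, hζ, one_zpow, Units.val_one, one_mul]

/-- Hensel's lemma for cubic equations over power series. -/
theorem exists_cubic_root (a₂ a₁ a₀ : PowerSeries Ω) (c : Ω)
    (h : c ^ 3 + PowerSeries.constantCoeff a₂ * c ^ 2 + PowerSeries.constantCoeff a₁ * c +
      PowerSeries.constantCoeff a₀ = 0)
    (h' : 3 * c ^ 2 + 2 * PowerSeries.constantCoeff a₂ * c + PowerSeries.constantCoeff a₁ ≠ 0) :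
    ∃ z : PowerSeries Ω, z ^ 3 + a₂ * z ^ 2 + a₁ * z + a₀ = 0 ∧
      PowerSeries.constantCoeff z = c := by
  let P : (PowerSeries Ω)[X] := X ^ 3 + C a₂ * X ^ 2 + C a₁ * X + C a₀
  have hP : P.Monic := by
    simp only [P]
    monicity!
  obtain ⟨z, hz, hzc⟩ := HenselianRing.is_henselian (I := Ideal.span {PowerSeries.X}) P hP
    (PowerSeries.C c)
    (by
      rw [Ideal.mem_span_singleton, PowerSeries.X_dvd_iff]
      simpa [P] using h)
    (by
      apply IsUnit.map
      rw [PowerSeries.isUnit_iff_constantCoeff, isUnit_iff_ne_zero]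
      convert h' using 1
      simp [P, map_ofNat PowerSeries.constantCoeff 2]
      ring)
  refine ⟨z, by simpa [P] using hz, ?_⟩
  rw [Ideal.mem_span_singleton, PowerSeries.X_dvd_iff, map_sub, PowerSeries.constantCoeff_C,
    sub_eq_zero] at hzc
  exact hzc

/-- The embedding of power series into Laurent series. -/
abbrev toLaurent : PowerSeries Ω →+* HahnSeries ℤ Ω := HahnSeries.ofPowerSeries ℤ Ω

theorem toLaurent_injective : Function.Injective (toLaurent (Ω := Ω)) :=
  HahnSeries.ofPowerSeries_injective

theorem coeff_toLaurent (φ : PowerSeries Ω) (n : ℕ) :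
    (toLaurent φ).coeff n = PowerSeries.coeff n φ :=
  HahnSeries.ofPowerSeries_apply_coeff φ n

theorem coeff_toLaurent_zero (φ : PowerSeries Ω) :
    (toLaurent φ).coeff 0 = PowerSeries.constantCoeff φ := by
  rw [← PowerSeries.coeff_zero_eq_constantCoeff_apply]
  exact coeff_toLaurent φ 0

theorem coeff_toLaurent_of_neg (φ : PowerSeries Ω) {n : ℤ} (hn : n < 0) :
    (toLaurent φ).coeff n = 0 := by
  rw [toLaurent, PowerSeries.coeff_coe, if_pos hn]

theorem exists_toLaurent_eq {x : HahnSeries ℤ Ω} (hx : ∀ n < 0, x.coeff n = 0) :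
    ∃ φ : PowerSeries Ω, toLaurent φ = x := by
  refine ⟨PowerSeries.mk fun n => x.coeff n, ?_⟩
  ext n
  rcases lt_or_ge n 0 with hn | hn
  · rw [coeff_toLaurent_of_neg _ hn, hx n hn]
  · obtain ⟨m, rfl⟩ := Int.eq_ofNat_of_zero_le hn
    rw [coeff_toLaurent, PowerSeries.coeff_mk]

theorem exists_toLaurent_mul_eq {x : HahnSeries ℤ Ω} (m : ℤ) (hx : ∀ n < m, x.coeff n = 0) :
    ∃ φ : PowerSeries Ω, x = HahnSeries.single m 1 * toLaurent φ ∧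
      PowerSeries.constantCoeff φ = x.coeff m := by
  obtain ⟨φ, hφ⟩ := exists_toLaurent_eq (x := HahnSeries.single (-m) 1 * x) (fun n hn => by
    rw [HahnSeries.coeff_single_mul, one_mul]
    exact hx _ (by omega))
  refine ⟨φ, ?_, ?_⟩
  · rw [hφ, ← mul_assoc, HahnSeries.single_mul_single]
    simp
  · rw [← coeff_toLaurent_zero, hφ, HahnSeries.coeff_single_mul, one_mul]
    congr 1
    omega

theorem dilate_toLaurent (p : ℕ) (hp : 0 < p) (φ : PowerSeries Ω) :
    ∃ φ' : PowerSeries Ω, dilate p hp (toLaurent φ) = toLaurent φ' ∧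
      PowerSeries.constantCoeff φ' = PowerSeries.constantCoeff φ := by
  obtain ⟨φ', h⟩ := exists_toLaurent_eq (x := dilate p hp (toLaurent φ)) (fun n hn => by
    by_cases hd : (p : ℤ) ∣ n
    · obtain ⟨m, rfl⟩ := hd
      rw [coeff_dilate_mul]
      exact coeff_toLaurent_of_neg _ (by nlinarith)
    · exact coeff_dilate_of_not_dvd p hp _ n hd)
  refine ⟨φ', h.symm, ?_⟩
  rw [← coeff_toLaurent_zero, h, coeff_dilate_zero, coeff_toLaurent_zero]

end Laurent

/-! ### Fibres of `f` in Laurent series -/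

section Places

variable {Ω : Type*} [Field Ω]

/-- The nonzero power series whose constant coefficient is not `1`. -/
def zeroPlace (Ω : Type*) [Field Ω] : Set (HahnSeries ℤ Ω) :=
  {y | (∀ n < 0, y.coeff n = 0) ∧ y ≠ 0 ∧ y.coeff 0 ≠ 1}

/-- The series of order `m`. -/
def ofOrder (Ω : Type*) [Field Ω] (m : ℤ) : Set (HahnSeries ℤ Ω) :=
  {y | (∀ n < m, y.coeff n = 0) ∧ y.coeff m ≠ 0}

theorem single_mul_toLaurent_mem_ofOrder (m : ℤ) {v : PowerSeries Ω}
    (hv : PowerSeries.constantCoeff v ≠ 0) :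
    HahnSeries.single m 1 * toLaurent v ∈ ofOrder Ω m := by
  refine ⟨fun n hn => ?_, ?_⟩
  · rw [HahnSeries.coeff_single_mul, coeff_toLaurent_of_neg _ (by omega), mul_zero]
  · rw [HahnSeries.coeff_single_mul, sub_self, coeff_toLaurent_zero, one_mul]
    exact hv

theorem toLaurent_X_pow (m : ℕ) :
    toLaurent (PowerSeries.X ^ m : PowerSeries Ω) = HahnSeries.single (m : ℤ) 1 := by
  simp [toLaurent]

theorem eval_f_toLaurent (z : PowerSeries Ω) :
    (f _).eval (toLaurent z) = toLaurent (-2 * z ^ 3 + 3 * z ^ 2) := by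
  rw [eval_f]
  simp only [map_add, map_mul, map_neg, map_ofNat, map_pow]

theorem twist_ne_self {ζ : Ωˣ} (hζ : ζ ≠ 1) {m : ℤ} (hm : m = 1 ∨ m = -1) {z : HahnSeries ℤ Ω}
    (hz : z ∈ ofOrder Ω m) : twist ζ z ≠ z := by
  intro h
  have h1 := congrArg (fun x => x.coeff m) h
  simp only [coeff_twist] at h1
  have h2 : ((ζ ^ m : Ωˣ) : Ω) = 1 := mul_right_cancel₀ hz.2 (h1.trans (one_mul _).symm)
  have h3 : ζ ^ m = 1 := Units.ext h2
  rcases hm with rfl | rfl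
  · exact hζ (by simpa using h3)
  · exact hζ (by simpa using h3)

variable [CharZero Ω] [IsAlgClosed Ω]

/-- Away from the critical values `0` and `1` the three residual roots are simple, so each lifts by
Hensel's lemma. -/
theorem exists_powerSeries_fibre_of_ne {u : PowerSeries Ω} (h0 : PowerSeries.constantCoeff u ≠ 0)
    (h1 : PowerSeries.constantCoeff u ≠ 1) : ∃ z : Fin 3 → PowerSeries Ω, Function.Injective z ∧
      ∀ i, -2 * z i ^ 3 + 3 * z i ^ 2 = u := by
  obtain ⟨o, ho, hf⟩ := exists_fibre h0 h1
  simp only [eval_f] at hf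
  have hroot : ∀ i, ∃ z : PowerSeries Ω, z ^ 3 + PowerSeries.C (-3 / 2 : Ω) * z ^ 2 + 0 * z +
      PowerSeries.C (1 / 2 : Ω) * u = 0 ∧ PowerSeries.constantCoeff z = o i := by
    intro i
    apply exists_cubic_root
    · simp only [PowerSeries.constantCoeff_C, map_mul, map_zero]
      linear_combination (-1 / 2 : Ω) * hf i
    · have e0 : o i ≠ 0 := fun h => h0 (by rw [← hf i, h]; ring)
      have e1 : o i - 1 ≠ 0 := fun h => h1 (by rw [← hf i, sub_eq_zero.mp h]; ring)
      have := mul_ne_zero (three_ne_zero (α := Ω)) (mul_ne_zero e0 e1)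
      simp only [PowerSeries.constantCoeff_C, map_zero]
      convert this using 1
      ring
  choose z hz hzo using hroot
  refine ⟨z, fun i j hij => ho (by rw [← hzo, ← hzo, hij]), fun i => ?_⟩
  have e1 : (2 : PowerSeries Ω) * PowerSeries.C (-3 / 2 : Ω) = -3 := by
    rw [← map_ofNat PowerSeries.C 2, ← map_mul, ← map_ofNat PowerSeries.C 3, ← map_neg]
    congr 1
    ring
  have e2 : (2 : PowerSeries Ω) * PowerSeries.C (1 / 2 : Ω) = 1 := by
    rw [← map_ofNat PowerSeries.C 2, ← map_mul, ← map_one PowerSeries.C]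
    congr 1
    ring
  linear_combination -2 * hz i + z i ^ 2 * e1 + u * e2

/-- Modulo `X` the roots are `0`, `0` and `3/2`. The last lifts directly; the double root separates
because the order `2 * m` is even, and gives two roots of order `m`. -/
theorem exists_powerSeries_fibre_of_eq {w : PowerSeries Ω} (hw : PowerSeries.constantCoeff w ≠ 0)
    {m : ℕ} (hm : 0 < m) : ∃ z : Fin 3 → PowerSeries Ω, Function.Injective z ∧
      (∀ i, -2 * z i ^ 3 + 3 * z i ^ 2 = PowerSeries.X ^ (2 * m) * w) ∧
      ∃ v, PowerSeries.constantCoeff v ≠ 0 ∧ z 0 = PowerSeries.X ^ m * v := by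
  have hX : PowerSeries.constantCoeff (PowerSeries.X ^ m : PowerSeries Ω) = 0 := by
    rw [map_pow, PowerSeries.constantCoeff_X, zero_pow hm.ne']
  have hX' : PowerSeries.constantCoeff (PowerSeries.X ^ (2 * m) : PowerSeries Ω) = 0 := by
    rw [map_pow, PowerSeries.constantCoeff_X, zero_pow (by omega)]
  have hww := PowerSeries.mul_inv_cancel w hw
  set c := PowerSeries.constantCoeff w with hc
  have hwc : PowerSeries.constantCoeff w⁻¹ = c⁻¹ := by
    have := congrArg PowerSeries.constantCoeff hww
    rw [map_mul, map_one] at this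
    exact eq_inv_of_mul_eq_one_right this
  obtain ⟨r, hr⟩ := IsAlgClosed.exists_eq_mul_self (3 * c⁻¹)
  have hr0 : r ≠ 0 := by
    rintro rfl
    rw [mul_zero] at hr
    exact mul_ne_zero three_ne_zero (inv_ne_zero hw) hr
  -- The substitution `z = X^m / v` turns the equation into `w v³ = 3 v - 2 X^m`, monic after
  -- division by the unit `w`. Its residual roots `± r`, with `r² = 3 / c`, are simple. Substituting
  -- `z = X^m v` would not give a unit leading coefficient.
  have hroot : ∀ s : Ω, s * s = r * r → ∃ v : PowerSeries Ω,
      v ^ 3 + 0 * v ^ 2 + (-3 * w⁻¹) * v + 2 * PowerSeries.X ^ m * w⁻¹ = 0 ∧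
      PowerSeries.constantCoeff v = s := by
    intro s hs
    apply exists_cubic_root
    · simp only [map_mul, map_zero, map_neg, map_ofNat, hX, hwc]
      linear_combination s * hs - s * hr
    · simp only [map_mul, map_zero, map_neg, map_ofNat, hwc]
      have := mul_ne_zero (two_ne_zero (α := Ω)) (mul_ne_zero hr0 hr0)
      convert this using 1
      linear_combination 3 * hs - hr
  obtain ⟨v₁, h₁, hv₁⟩ := hroot r rfl
  obtain ⟨v₂, h₂, hv₂⟩ := hroot (-r) (by ring)
  obtain ⟨z₃, h₃, hz₃⟩ : ∃ z : PowerSeries Ω, z ^ 3 + PowerSeries.C (-3 / 2 : Ω) * z ^ 2 + 0 * z +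
      PowerSeries.C (1 / 2 : Ω) * (PowerSeries.X ^ (2 * m) * w) = 0 ∧
      PowerSeries.constantCoeff z = 3 / 2 := by
    apply exists_cubic_root
    · simp only [PowerSeries.constantCoeff_C, map_mul, map_zero, hX']
      ring
    · simp only [PowerSeries.constantCoeff_C, map_zero]
      norm_num
  have e1 : (2 : PowerSeries Ω) * PowerSeries.C (-3 / 2 : Ω) = -3 := by
    rw [← map_ofNat PowerSeries.C 2, ← map_mul, ← map_ofNat PowerSeries.C 3, ← map_neg]
    congr 1
    ring
  have e2 : (2 : PowerSeries Ω) * PowerSeries.C (1 / 2 : Ω) = 1 := by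
    rw [← map_ofNat PowerSeries.C 2, ← map_mul, ← map_one PowerSeries.C]
    congr 1
    ring
  have hsol : ∀ v : PowerSeries Ω, PowerSeries.constantCoeff v ≠ 0 →
      v ^ 3 + 0 * v ^ 2 + (-3 * w⁻¹) * v + 2 * PowerSeries.X ^ m * w⁻¹ = 0 →
      -2 * (PowerSeries.X ^ m * v⁻¹) ^ 3 + 3 * (PowerSeries.X ^ m * v⁻¹) ^ 2 =
        PowerSeries.X ^ (2 * m) * w := by
    intro v hv h
    have hvv := PowerSeries.mul_inv_cancel v hv
    have h' : v ^ 3 * w = 3 * v - 2 * PowerSeries.X ^ m := by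
      linear_combination w * h + (3 * v - 2 * PowerSeries.X ^ m) * hww
    have h3 : v ^ 3 * v⁻¹ ^ 3 = 1 := by rw [← mul_pow, hvv, one_pow]
    calc -2 * (PowerSeries.X ^ m * v⁻¹) ^ 3 + 3 * (PowerSeries.X ^ m * v⁻¹) ^ 2
        = PowerSeries.X ^ (2 * m) * v⁻¹ ^ 3 * (3 * v - 2 * PowerSeries.X ^ m) := by
          rw [pow_mul']
          linear_combination (-3 * (PowerSeries.X ^ m) ^ 2 * v⁻¹ ^ 2) * hvv
      _ = PowerSeries.X ^ (2 * m) * w := by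
          rw [← h']
          linear_combination (PowerSeries.X ^ (2 * m) * w) * h3
  have hc₁ : PowerSeries.constantCoeff v₁ ≠ 0 := by rw [hv₁]; exact hr0
  have hc₂ : PowerSeries.constantCoeff v₂ ≠ 0 := by rw [hv₂]; exact neg_ne_zero.mpr hr0
  have h32 : (3 / 2 : Ω) ≠ 0 := by norm_num
  have hz₃' : ∀ v : PowerSeries Ω, PowerSeries.X ^ m * v ≠ z₃ := by
    intro v h
    apply h32
    rw [← hz₃, ← h, map_mul, hX, zero_mul]
  have h12 : PowerSeries.X ^ m * v₁⁻¹ ≠ PowerSeries.X ^ m * v₂⁻¹ := by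
    intro h
    have h' := mul_left_cancel₀ (pow_ne_zero m PowerSeries.X_ne_zero) h
    have e₁ := PowerSeries.mul_inv_cancel v₁ hc₁
    have e₂ := PowerSeries.mul_inv_cancel v₂ hc₂
    have h4 : v₁ = v₂ := by
      linear_combination -(v₁ * v₂) * h' + v₂ * e₁ - v₁ * e₂
    have h5 := congrArg PowerSeries.constantCoeff h4
    rw [hv₁, hv₂] at h5
    exact hr0 (self_eq_neg.mp h5)
  refine ⟨![PowerSeries.X ^ m * v₁⁻¹, PowerSeries.X ^ m * v₂⁻¹, z₃], ?_, ?_, v₁⁻¹, ?_, rfl⟩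
  · exact injective_of_ne h12 (hz₃' _) (hz₃' _)
  · intro i
    fin_cases i
    · exact hsol v₁ hc₁ h₁
    · exact hsol v₂ hc₂ h₂
    · change -2 * z₃ ^ 3 + 3 * z₃ ^ 2 = _
      linear_combination -2 * h₃ + z₃ ^ 2 * e1 + (PowerSeries.X ^ (2 * m) * w) * e2
  · intro h
    have := congrArg PowerSeries.constantCoeff (PowerSeries.mul_inv_cancel v₁ hc₁)
    rw [map_mul, h, mul_zero, map_one] at this
    exact zero_ne_one this

theorem exists_fibre_of_ofOrder_pos {y : HahnSeries ℤ Ω} {m : ℕ} (hm : 0 < m)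
    (hy : y ∈ ofOrder Ω m) : ∃ z : Fin 3 → PowerSeries Ω, Function.Injective z ∧
      (∀ i, toLaurent (-2 * z i ^ 3 + 3 * z i ^ 2) = dilate 2 two_pos y) ∧
      toLaurent (z 0) ∈ ofOrder Ω m := by
  obtain ⟨φ, hφ, hc⟩ := exists_toLaurent_mul_eq m hy.1
  obtain ⟨w, hw, hwc⟩ := dilate_toLaurent 2 two_pos φ
  obtain ⟨z, hz, hf, v, hv, hzv⟩ := exists_powerSeries_fibre_of_eq (w := w)
    (by rw [hwc, hc]; exact hy.2) hm
  refine ⟨z, hz, fun i => ?_, ?_⟩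
  · rw [hf, map_mul, hφ, map_mul, hw, dilate_single, toLaurent_X_pow]
    simp
  · rw [hzv, map_mul, toLaurent_X_pow]
    exact single_mul_toLaurent_mem_ofOrder _ hv

/-- Constant coefficient `1` is excluded because `1` is the other finite critical value; the
condition passes to preimages as `f(1) = 1`. Above constant coefficient `0`, the substitution `X ↦
X²` makes the order even. -/
theorem exists_fibre_zeroPlace {y : HahnSeries ℤ Ω} (hy : y ∈ zeroPlace Ω) :
    ∃ o : Fin 3 → HahnSeries ℤ Ω, Function.Injective o ∧
      ∀ i, (f _).eval (o i) = dilate 2 two_pos y ∧ o i ∈ zeroPlace Ω := by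
  suffices h : ∃ z : Fin 3 → PowerSeries Ω, Function.Injective z ∧
      ∀ i, toLaurent (-2 * z i ^ 3 + 3 * z i ^ 2) = dilate 2 two_pos y by
    obtain ⟨z, hz, hf⟩ := h
    refine ⟨fun i => toLaurent (z i), toLaurent_injective.comp hz, fun i => ⟨?_, ?_, ?_, ?_⟩⟩
    · rw [eval_f_toLaurent, hf]
    · exact fun n hn => coeff_toLaurent_of_neg _ hn
    · intro h
      have h' : z i = 0 := toLaurent_injective (h.trans (map_zero _).symm)
      have h2 := hf i
      rw [h'] at h2
      refine hy.2.1 ((dilate 2 two_pos).injective ?_)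
      rw [← h2]
      simp
    · intro h
      have h1 : PowerSeries.constantCoeff (z i) = 1 := (coeff_toLaurent_zero _).symm.trans h
      have h2 := congrArg (fun x => x.coeff 0) (hf i)
      rw [coeff_toLaurent_zero, coeff_dilate_zero] at h2
      simp only [map_add, map_mul, map_neg, map_ofNat, map_pow, h1] at h2
      refine hy.2.2 (h2.symm.trans ?_)
      norm_num
  by_cases h0 : y.coeff 0 = 0
  · have hord := mt HahnSeries.coeff_order_eq_zero.mp hy.2.1
    have hpos : 0 < y.order := by
      rcases lt_trichotomy y.order 0 with h | h | h
      · exact absurd (hy.1 _ h) hord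
      · rw [h] at hord
        exact absurd h0 hord
      · exact h
    obtain ⟨m, hm⟩ := Int.eq_ofNat_of_zero_le hpos.le
    obtain ⟨z, hz, hf, -⟩ := exists_fibre_of_ofOrder_pos (y := y) (m := m) (by omega)
      ⟨fun n hn => HahnSeries.coeff_eq_zero_of_lt_order (by omega), by rwa [hm] at hord⟩
    exact ⟨z, hz, hf⟩
  · obtain ⟨φ, rfl⟩ := exists_toLaurent_eq hy.1
    obtain ⟨u, hu, huc⟩ := dilate_toLaurent 2 two_pos φ
    rw [coeff_toLaurent_zero] at h0
    have h1 := hy.2.2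
    rw [coeff_toLaurent_zero] at h1
    obtain ⟨z, hz, hf⟩ := exists_powerSeries_fibre_of_ne (u := u) (by rwa [huc]) (by rwa [huc])
    exact ⟨z, hz, fun i => by rw [hf, hu]⟩

/-- One ramified branch above `0` suffices: the third preimage has constant coefficient `3/2` and is
not of order one. -/
theorem exists_eval_f_eq_of_order_one {y : HahnSeries ℤ Ω} (hy : y ∈ ofOrder Ω 1) :
    ∃ z ∈ ofOrder Ω 1, (f _).eval z = dilate 2 two_pos y := by
  obtain ⟨z, -, hf, h0⟩ := exists_fibre_of_ofOrder_pos (m := 1) one_pos hy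
  exact ⟨_, h0, by rw [eval_f_toLaurent, hf]⟩

/-- A primitive third root of unity. -/
theorem exists_cube_root_of_unity : ∃ ζ : Ωˣ, ζ ^ 3 = 1 ∧ ζ ≠ 1 := by
  obtain ⟨s, hs⟩ := IsAlgClosed.exists_eq_mul_self (-3 : Ω)
  have h : ((s - 1) / 2) ^ 2 + (s - 1) / 2 + 1 = 0 := by linear_combination (-1 / 4 : Ω) * hs
  have h3 : ((s - 1) / 2) ^ 3 = 1 := by linear_combination ((s - 1) / 2 - 1) * h
  refine ⟨Units.ofPowEqOne _ 3 h3 three_ne_zero, Units.ext (by simp), fun h1 => ?_⟩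
  have h2 := congrArg Units.val h1
  simp only [Units.val_ofPowEqOne, Units.val_one] at h2
  rw [h2] at h
  norm_num at h

theorem exists_fibre_infinitePlace {y : HahnSeries ℤ Ω} (hy : y ∈ ofOrder Ω (-1)) :
    ∃ o : Fin 3 → HahnSeries ℤ Ω, Function.Injective o ∧
      ∀ i, (f _).eval (o i) = dilate 3 three_pos y ∧ o i ∈ ofOrder Ω (-1) := by
  obtain ⟨φ, hφ, hc⟩ := exists_toLaurent_mul_eq (-1) hy.1
  obtain ⟨w, hw, hwc⟩ := dilate_toLaurent 3 three_pos φ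
  have hw0 : PowerSeries.constantCoeff w ≠ 0 := by
    rw [hwc, hc]
    exact hy.2
  obtain ⟨r, hr⟩ := IsAlgClosed.exists_pow_nat_eq (-(PowerSeries.constantCoeff w) / 2) three_pos
  have hr0 : r ≠ 0 := by
    rintro rfl
    refine hw0 ?_
    linear_combination 2 * hr
  obtain ⟨ζ, hζ, hζ1⟩ := exists_cube_root_of_unity (Ω := Ω)
  -- With `z = X⁻¹ v` and right-hand side `X⁻³ w`, the equation becomes `v³ - (3/2) X v² + w/2 = 0`.
  -- Modulo `X` this is `v³ = -w(0)/2`, with the simple roots `r ζⁱ`.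
  have hroot : ∀ i : Fin 3, ∃ v : PowerSeries Ω, v ^ 3 +
      (PowerSeries.C (-3 / 2 : Ω) * PowerSeries.X) * v ^ 2 + 0 * v + PowerSeries.C (1 / 2 : Ω) * w
        = 0 ∧ PowerSeries.constantCoeff v = r * ((ζ ^ (i : ℕ) : Ωˣ) : Ω) := by
    intro i
    have hi : ((ζ ^ (i : ℕ) : Ωˣ) : Ω) ^ 3 = 1 := by
      rw [← Units.val_pow_eq_pow_val, ← pow_mul, mul_comm, pow_mul, hζ, one_pow, Units.val_one]
    apply exists_cubic_root
    · simp only [PowerSeries.constantCoeff_C, map_mul, map_zero, PowerSeries.constantCoeff_X]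
      linear_combination r ^ 3 * hi + hr
    · simp only [PowerSeries.constantCoeff_C, map_mul, map_zero, PowerSeries.constantCoeff_X]
      have := mul_ne_zero (three_ne_zero (α := Ω))
        (pow_ne_zero 2 (mul_ne_zero hr0 (ζ ^ (i : ℕ)).ne_zero))
      convert this using 1
      ring
  choose v hv hvc using hroot
  refine ⟨fun i => HahnSeries.single (-1) 1 * toLaurent (v i), ?_, fun i => ⟨?_, ?_⟩⟩
  · intro i j hij
    have h1 := mul_left_cancel₀ (HahnSeries.single_ne_zero one_ne_zero) hij
    have h2 := congrArg PowerSeries.constantCoeff (toLaurent_injective h1)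
    rw [hvc, hvc] at h2
    have h3 : ζ ^ (i : ℕ) = ζ ^ (j : ℕ) := Units.ext (mul_left_cancel₀ hr0 h2)
    have hord : orderOf ζ = 3 := orderOf_eq_prime hζ hζ1
    exact Fin.ext (pow_injOn_Iio_orderOf (by simp [hord]) (by simp [hord]) h3)
  · have e1 : (2 : PowerSeries Ω) * PowerSeries.C (-3 / 2 : Ω) = -3 := by
      rw [← map_ofNat PowerSeries.C 2, ← map_mul, ← map_ofNat PowerSeries.C 3, ← map_neg]
      congr 1
      ring
    have e2 : (2 : PowerSeries Ω) * PowerSeries.C (1 / 2 : Ω) = 1 := by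
      rw [← map_ofNat PowerSeries.C 2, ← map_mul, ← map_one PowerSeries.C]
      congr 1
      ring
    have h1 : w = -2 * v i ^ 3 + 3 * PowerSeries.X * v i ^ 2 := by
      linear_combination 2 * hv i - PowerSeries.X * v i ^ 2 * e1 - w * e2
    have hX : toLaurent (PowerSeries.X : PowerSeries Ω) = HahnSeries.single 1 1 := by
      simp [toLaurent]
    have h3 : (HahnSeries.single (-3) 1 : HahnSeries ℤ Ω) = HahnSeries.single (-1) 1 ^ 3 := by
      simp
    have h2 : (HahnSeries.single (-3) 1 : HahnSeries ℤ Ω) * HahnSeries.single 1 1 =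
        HahnSeries.single (-1) 1 ^ 2 := by
      simp
    have h4 : (HahnSeries.single (((3 : ℕ) : ℤ) * -1) 1 : HahnSeries ℤ Ω) =
        HahnSeries.single (-3) 1 := by
      norm_num
    rw [hφ, map_mul, dilate_single, hw, eval_f, h1, h4]
    simp only [map_add, map_mul, map_neg, map_ofNat, map_pow, hX]
    linear_combination (2 * toLaurent (v i) ^ 3) * h3 - 3 * toLaurent (v i) ^ 2 * h2
  · refine single_mul_toLaurent_mem_ofOrder _ ?_
    rw [hvc]
    exact mul_ne_zero hr0 (Units.ne_zero _)

end Places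

/-! ### Elements of order two and three of the Galois groups -/

section GaloisElements

variable {k Ω : Type*} [Field k] [Field Ω] [Algebra k Ω]

/-- An embedding of `k(t)` that maps `t` to an element that is not algebraic over the image of the
algebraically closed field `Ω`. -/
theorem exists_embedding_of_notMem_range [IsAlgClosed Ω] {F : Type*} [Field F] (c : Ω →+* F) {T : F}
    (hT : T ∉ c.range) {t : Ω} (ht : Transcendental k t) : ∃ ψ : k⟮t⟯ →+* F, ψ (base k t) = T ∧
      ∀ θ : F →+* F, (∀ a, θ (c a) = c a) → θ T = T → ∀ x, θ (ψ x) = ψ x := by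
  let _ : Algebra Ω F := c.toAlgebra
  let _ : Algebra k F := (c.comp (algebraMap k Ω)).toAlgebra
  have : IsScalarTower k Ω F := IsScalarTower.of_algebraMap_eq fun _ => rfl
  -- An element algebraic over the algebraically closed field `Ω` already lies in its image.
  have h : Transcendental Ω T := by
    intro halg
    exact hT (minpoly.mem_range_of_degree_eq_one Ω T
      (IsAlgClosed.degree_eq_one_of_irreducible Ω (minpoly.irreducible halg.isIntegral)))
  have hTk : Transcendental k T := h.of_tower_top k
  let ψ : k⟮t⟯ →ₐ[k] F := (IntermediateField.val _).comp
    ((RatFunc.algEquivOfTranscendental t ht).symm.trans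
      (RatFunc.algEquivOfTranscendental T hTk)).toAlgHom
  have hψ : ψ (base k t) = T := by
    change ((RatFunc.algEquivOfTranscendental T hTk ((RatFunc.algEquivOfTranscendental t ht).symm
      (AdjoinSimple.gen k t)) : k⟮T⟯) : F) = T
    rw [RatFunc.algEquivOfTranscendental_symm_gen, RatFunc.algEquivOfTranscendental_X]
  refine ⟨ψ, hψ, fun θ hθ hθT x => ?_⟩
  let Θ : F →ₐ[k] F := { θ with commutes' := fun a => hθ _ }
  have hext : Θ.comp ψ = ψ := by
    refine adjoin_algHom_ext k fun y hy => ?_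
    obtain rfl : y = t := hy
    change θ (ψ (base k y)) = ψ (base k y)
    rw [hψ, hθT]
  exact DFunLike.congr_fun hext x

/-- An embedding of `k(t)` into Laurent series that maps `t` to a power of the variable. -/
theorem exists_embedding [IsAlgClosed Ω] {t : Ω} (ht : Transcendental k t) {m : ℤ} (hm : m ≠ 0)
    {ζ : Ωˣ} (hζ : ζ ^ m = 1) : ∃ ψ : k⟮t⟯ →+* HahnSeries ℤ Ω,
      ψ (base k t) = HahnSeries.single m 1 ∧ ∀ x, twist ζ (ψ x) = ψ x := by
  obtain ⟨ψ, hψ, h⟩ := exists_embedding_of_notMem_range (HahnSeries.C (Γ := ℤ) (R := Ω))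
    (T := HahnSeries.single m 1) (by
      rintro ⟨c, hc⟩
      have h1 := congrArg (fun x => x.coeff m) hc
      simp only [HahnSeries.coeff_single_same, HahnSeries.C_apply] at h1
      rw [HahnSeries.coeff_single_of_ne hm] at h1
      exact zero_ne_one h1) ht
  refine ⟨ψ, hψ, h _ (twist_C ζ) ?_⟩
  ext n
  rw [coeff_twist]
  by_cases hn : n = m
  · subst hn
    rw [hζ, Units.val_one, one_mul]
  · rw [HahnSeries.coeff_single_of_ne hn, mul_zero]

theorem iterate_dilate_single (p : ℕ) (hp : 0 < p) (m : ℤ) (n : ℕ) :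
    (dilate p hp)^[n] (HahnSeries.single m (1 : Ω)) = HahnSeries.single ((p : ℤ) ^ n * m) 1 := by
  induction n with
  | zero => simp
  | succ n ih => rw [Function.iterate_succ_apply', ih, dilate_single, pow_succ', mul_assoc]

theorem single_mem_ofOrder (m : ℤ) : HahnSeries.single m (1 : Ω) ∈ ofOrder Ω m :=
  ⟨fun _ hn => HahnSeries.coeff_single_of_ne hn.ne, by
    rw [HahnSeries.coeff_single_same]
    exact one_ne_zero⟩

variable [CharZero Ω] [IsAlgClosed Ω] {t : Ω}

/-- The exponent `p ^ (n + 1) * m` for `t` is what `n + 1` dilations make of `X^m`; being divisible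
by `p`, it leaves the image of `k(t)` fixed under `X ↦ ζX`. -/
theorem exists_gal_pow_eq_one (ht : Transcendental k t) {p : ℕ} (hp : 0 < p) {ζ : Ωˣ}
    (hζp : ζ ^ p = 1) (hζ : ζ ≠ 1) {m : ℤ} (hm : m = 1 ∨ m = -1) {A : Set (HahnSeries ℤ Ω)}
    (hA : ∀ y ∈ A, ∃ o : Fin 3 → HahnSeries ℤ Ω, Function.Injective o ∧
      ∀ i, (f _).eval (o i) = dilate p hp y ∧ o i ∈ A)
    (hT : HahnSeries.single m 1 ∈ A)
    (hB : ∀ y ∈ ofOrder Ω m, ∃ z ∈ ofOrder Ω m, (f _).eval z = dilate p hp y) (n : ℕ) :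
    ∃ σ : Gal(splitField Ω (base k t) (n + 1)/k⟮t⟯), σ ^ p = 1 ∧ σ ≠ 1 ∧
      ∀ x : splitField Ω (base k t) (n + 1),
        (fun z => (f Ω).eval z)^[n] x.1 = t → σ x = x := by
  obtain ⟨ψ, hψ, hθ⟩ := exists_embedding ht (m := (p : ℤ) ^ (n + 1) * m)
    (mul_ne_zero (by positivity) (by omega)) (ζ := ζ) (by
      rw [pow_succ', mul_assoc, zpow_mul, zpow_natCast, hζp, one_zpow])
  have : CharZero (HahnSeries ℤ Ω) := charZero_of_injective_ringHom HahnSeries.C_injective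
  exact exists_gal_of_tower (T := HahnSeries.single m 1) hA hT (single_mem_ofOrder m) hB
    (twist_dilate hp hζp) (fun z hz => twist_ne_self hζ hm hz) (iterate_twist hζp) n ψ
    (by rw [hψ, iterate_dilate_single]) hθ

/-- Inertia at `t = 0`, a fixed point of `f` with ramification index two. -/
theorem exists_gal_sq_eq_one (ht : Transcendental k t) (n : ℕ) :
    ∃ σ : Gal(splitField Ω (base k t) (n + 1)/k⟮t⟯), σ ^ 2 = 1 ∧ σ ≠ 1 ∧
      ∀ x : splitField Ω (base k t) (n + 1),
        (fun z => (f Ω).eval z)^[n] x.1 = t → σ x = x := by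
  refine exists_gal_pow_eq_one ht two_pos (ζ := -1) (m := 1) (by simp) (fun h => ?_) (.inl rfl)
    (fun y hy => exists_fibre_zeroPlace hy) ?_ (fun y hy => exists_eval_f_eq_of_order_one hy) n
  · have h1 := congrArg Units.val h
    norm_num at h1
  · refine ⟨fun n hn => HahnSeries.coeff_single_of_ne (by omega),
      HahnSeries.single_ne_zero one_ne_zero, ?_⟩
    rw [HahnSeries.coeff_single_of_ne (by decide)]
    exact zero_ne_one

/-- Inertia at `t = ∞`, where the polynomial `f` is totally ramified; here every branch may serve as
the ramified one. -/
theorem exists_gal_cube_eq_one (ht : Transcendental k t) (n : ℕ) :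
    ∃ σ : Gal(splitField Ω (base k t) (n + 1)/k⟮t⟯), σ ^ 3 = 1 ∧ σ ≠ 1 ∧
      ∀ x : splitField Ω (base k t) (n + 1),
        (fun z => (f Ω).eval z)^[n] x.1 = t → σ x = x := by
  obtain ⟨ζ, hζ3, hζ⟩ := exists_cube_root_of_unity (Ω := Ω)
  refine exists_gal_pow_eq_one ht three_pos hζ3 hζ (m := -1) (.inr rfl)
    (fun y hy => exists_fibre_infinitePlace hy) (single_mem_ofOrder _) (fun y hy => ?_) n
  obtain ⟨o, -, ho⟩ := exists_fibre_infinitePlace hy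
  exact ⟨o 0, (ho 0).2, (ho 0).1⟩

end GaloisElements

/-! ### The arboreal Galois groups -/

section Action

variable {K Ω : Type*} [Field K] [Field Ω] [Algebra K Ω] [CharZero Ω] [IsAlgClosed Ω]

instance normal_splitField (t : K) (n : ℕ) : Normal K (splitField Ω t n) :=
  Normal.of_isSplittingField (arborealPoly t n)

instance finiteDimensional_splitField (t : K) (n : ℕ) : FiniteDimensional K (splitField Ω t n) :=
  IsSplittingField.finiteDimensional _ (arborealPoly t n)

variable {t : K} {s : Node Ω} {n : ℕ}

theorem mem_splitField_of_iterate {i : ℕ} (hi : i ≤ n) {z : Ω}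
    (hz : (fun z => (f Ω).eval z)^[i] z = algebraMap K Ω t) : z ∈ splitField Ω t n :=
  splitField_mono t hi (subset_adjoin _ _ ((mem_rootSet t i z).mpr hz))

theorem lab_mem_splitField (hs : s.y = algebraMap K Ω t) {l : List (Fin 3)} (hl : l.length ≤ n) :
    lab s l ∈ splitField Ω t n :=
  mem_splitField_of_iterate hl ((iterate_lab s l).trans hs)

/-- The Galois automorphism `σ` acts on the labelled preimage tree by `a`. -/
def ActsBy (s : Node Ω) (σ : Gal(splitField Ω t n/K)) (a : AutT n) : Prop :=
  ∀ l : List (Fin 3), l.length ≤ n → ∀ x : splitField Ω t n, x.1 = lab s l →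
    (σ x).1 = lab s (act a l)

theorem exists_actsBy (hs : s.y = algebraMap K Ω t) (σ : Gal(splitField Ω t n/K)) :
    ∃ a ∈ E n, ActsBy s σ a := by
  refine exists_mem_E_lab (algebraMap (splitField Ω t n) Ω)
    ((algebraMap (splitField Ω t n) Ω).comp (σ : splitField Ω t n →+* splitField Ω t n)) n s s
    (fun w hw => ⟨⟨_, lab_mem_splitField hs hw⟩, rfl⟩) (fun x hx => ?_)
  have : x = algebraMap K _ t := Subtype.ext (hx.trans hs)
  rw [this, hs]
  exact congrArg Subtype.val (σ.commutes t)

theorem ActsBy.mul {σ τ : Gal(splitField Ω t n/K)} {a b : AutT n}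
    (ha : ActsBy s σ a) (hb : ActsBy s τ b) : ActsBy s (σ * τ) (a * b) := by
  intro l hl x hx
  rw [act_mul]
  exact ha _ (by rwa [length_act]) (τ x) (hb l hl x hx)

theorem actsBy_one : ActsBy s (1 : Gal(splitField Ω t n/K)) 1 := by
  intro l _ x hx
  rw [act_one, ← hx]
  rfl

theorem ActsBy.unique (hs : s.y = algebraMap K Ω t) {σ : Gal(splitField Ω t n/K)} {a b : AutT n}
    (ha : ActsBy s σ a) (hb : ActsBy s σ b) : a = b := by
  refine ext_act fun l hl => ?_
  have hx := lab_mem_splitField hs hl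
  refine lab_injective s _ _ (by rw [length_act, length_act]) ?_
  rw [← ha l hl ⟨_, hx⟩ rfl, hb l hl ⟨_, hx⟩ rfl]

omit [IsAlgClosed Ω] in
theorem gal_ext {σ τ : Gal(splitField Ω t n/K)} (h : ∀ x : splitField Ω t n,
    (fun z => (f Ω).eval z)^[n] x.1 = algebraMap K Ω t → σ x = τ x) : σ = τ := by
  have : (σ : splitField Ω t n →ₐ[K] splitField Ω t n) = τ :=
    adjoin_algHom_ext K fun x hx => h ⟨x, _⟩ ((mem_rootSet t n x).mp hx)
  exact AlgEquiv.ext fun x => DFunLike.congr_fun this x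

/-- The action is faithful because the preimages of level `n` generate the splitting field. -/
theorem ActsBy.gal_unique (hs : s.y = algebraMap K Ω t) {σ τ : Gal(splitField Ω t n/K)}
    {a : AutT n} (hσ : ActsBy s σ a) (hτ : ActsBy s τ a) : σ = τ := by
  refine gal_ext fun x hx => ?_
  obtain ⟨w, hw, hwx⟩ := exists_lab_eq s n (hx.trans hs.symm)
  exact Subtype.ext ((hσ w hw.le x hwx.symm).trans (hτ w hw.le x hwx.symm).symm)

/-- The image of the Galois group in `Aut(T_n)`. -/
def galImage (t : K) (s : Node Ω) (hs : s.y = algebraMap K Ω t) (n : ℕ) : Subgroup (AutT n) where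
  carrier := {a | ∃ σ : Gal(splitField Ω t n/K), ActsBy s σ a}
  one_mem' := ⟨1, actsBy_one⟩
  mul_mem' := fun ⟨σ, hσ⟩ ⟨τ, hτ⟩ => ⟨σ * τ, hσ.mul hτ⟩
  inv_mem' := by
    rintro a ⟨σ, hσ⟩
    obtain ⟨b, -, hb⟩ := exists_actsBy hs σ⁻¹
    have h := hσ.mul hb
    rw [mul_inv_cancel] at h
    rw [inv_eq_of_mul_eq_one_right (h.unique hs actsBy_one)]
    exact ⟨_, hb⟩

/-- The labelling as an isomorphism of `T_n` with the preimage tree. -/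
theorem exists_treeEquiv (hs : s.y = algebraMap K Ω t) :
    ∃ e : Vertex n ≃ PreimageVertex (splitField Ω t n) t n,
      (∀ v, (e v).1.1 = v.1.length ∧ (e v).1.2.1 = lab s v.1) ∧
      ∀ v, e v.parent = (e v).parent := by
  have hiter : ∀ (i : ℕ) (x : splitField Ω t n),
      (fun z => (f (splitField Ω t n)).eval z)^[i] x = algebraMap K _ t ↔
        (fun z => (f Ω).eval z)^[i] x.1 = algebraMap K Ω t := by
    intro i x
    rw [← (algebraMap (splitField Ω t n) Ω).injective.eq_iff, map_iterate_eval_f]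
    rfl
  let e₀ : Vertex n → PreimageVertex (splitField Ω t n) t n := fun v =>
    ⟨(v.1.length, ⟨lab s v.1, lab_mem_splitField hs v.2⟩), v.2,
      (hiter _ _).mpr ((iterate_lab s v.1).trans hs)⟩
  have hbij : Function.Bijective e₀ := by
    constructor
    · intro v w h
      have h1 := congrArg (fun p => p.1.1) h
      have h2 := congrArg (fun p => p.1.2.1) h
      exact Subtype.ext (lab_injective s _ _ h1 h2)
    · rintro ⟨⟨i, x⟩, hi, hx⟩
      obtain ⟨w, rfl, hw⟩ := exists_lab_eq s i (((hiter i x).mp hx).trans hs.symm)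
      exact ⟨⟨w, hi⟩, Subtype.ext (Prod.ext rfl (Subtype.ext hw))⟩
  refine ⟨Equiv.ofBijective e₀ hbij, fun v => ⟨rfl, rfl⟩, ?_⟩
  rintro ⟨l, hl⟩
  induction l using List.reverseRecOn with
  | nil => rfl
  | append_singleton l i _ =>
    have key : ∀ (p : PreimageVertex (splitField Ω t n) t n) (j : ℕ), p.1.1 = j + 1 →
        p.parent.1.1 = j ∧ p.parent.1.2.1 = (f Ω).eval p.1.2.1 := by
      rintro ⟨⟨m, x⟩, hm, hx⟩ j rfl
      exact ⟨rfl, map_eval_f (algebraMap (splitField Ω t n) Ω) x⟩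
    obtain ⟨h1, h2⟩ := key (e₀ ⟨l ++ [i], hl⟩) l.length (by simp [e₀])
    refine Subtype.ext (Prod.ext ?_ (Subtype.ext ?_))
    · refine Eq.trans ?_ h1.symm
      simp [e₀, Vertex.parent]
    · refine Eq.trans ?_ h2.symm
      simp [e₀, Vertex.parent, eval_lab_append]

theorem galIsoE_of_galImage_eq (hs : s.y = algebraMap K Ω t) (h : galImage t s hs n = E n) :
    GalIsoE (splitField Ω t n) t n := by
  obtain ⟨e, he, hpar⟩ := exists_treeEquiv (n := n) hs
  choose a haE ha using fun σ : Gal(splitField Ω t n/K) => exists_actsBy hs σ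
  let φ : Gal(splitField Ω t n/K) →* E n := MonoidHom.mk' (fun σ => ⟨a σ, haE σ⟩) fun σ τ =>
    Subtype.ext ((ha (σ * τ)).unique hs ((ha σ).mul (ha τ)))
  have hφ : Function.Bijective φ := by
    constructor
    · intro σ τ hστ
      have h1 : a σ = a τ := congrArg Subtype.val hστ
      have h2 := ha τ
      rw [← h1] at h2
      exact (ha σ).gal_unique hs h2
    · rintro ⟨b, hb⟩
      rw [← h] at hb
      obtain ⟨σ, hσ⟩ := hb
      exact ⟨σ, Subtype.ext ((ha σ).unique hs hσ)⟩
  refine ⟨e, MulEquiv.ofBijective φ hφ, hpar, fun σ v => ?_⟩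
  have hlen : ((a σ).1 v).1.length = v.1.length := by
    rw [← act_coe, length_act]
  refine Subtype.ext (Prod.ext ?_ (Subtype.ext ?_))
  · exact ((he _).1.trans hlen).trans (he v).1.symm
  · refine (he _).2.trans ?_
    have h1 := ha σ v.1 v.2 (e v).1.2 (he v).2
    rw [act_coe] at h1
    exact h1.symm

/-- Automorphisms of the field of level `n` extend to the normal extension of level `n + 1`. -/
theorem galImage_le_map_res (hs : s.y = algebraMap K Ω t) (n : ℕ) :
    galImage t s hs n ≤ (galImage t s hs (n + 1)).map res := by
  rintro a ⟨σ, hσ⟩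
  obtain ⟨i, hi⟩ : ∃ i : splitField Ω t n →ₐ[K] splitField Ω t (n + 1), ∀ y, (i y).1 = y.1 :=
    ⟨inclusion (splitField_mono t (Nat.le_succ n)), fun y => coe_inclusion _ y⟩
  obtain ⟨τ, hτ⟩ := exists_lift i σ
  obtain ⟨b, -, hb⟩ := exists_actsBy hs τ
  refine ⟨b, ⟨τ, hb⟩, ext_act fun l hl => ?_⟩
  rw [act_res b hl]
  refine lab_injective s _ _ (by rw [length_act, length_act]) ?_
  let x : splitField Ω t n := ⟨lab s l, lab_mem_splitField hs hl⟩
  rw [← hσ l hl x rfl, ← hb l (hl.trans (Nat.le_succ n)) (i x) (hi x), hτ, hi]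

theorem exists_mem_galImage_pow_eq_one (hs : s.y = algebraMap K Ω t) {n p : ℕ}
    (h : ∃ σ : Gal(splitField Ω t (n + 1)/K), σ ^ p = 1 ∧ σ ≠ 1 ∧ ∀ x : splitField Ω t (n + 1),
      (fun z => (f Ω).eval z)^[n] x.1 = algebraMap K Ω t → σ x = x) :
    ∃ g ∈ galImage t s hs (n + 1), res g = 1 ∧ g ≠ 1 ∧ g ^ p = 1 := by
  obtain ⟨σ, hp, hne, hfix⟩ := h
  obtain ⟨a, -, ha⟩ := exists_actsBy hs σ
  refine ⟨a, ⟨σ, ha⟩, ext_act_of_length_eq fun l hl => ?_, ?_, ?_⟩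
  · rw [act_res a hl.le, act_one]
    refine lab_injective s _ _ (length_act _ _) ?_
    have hl' : l.length ≤ n + 1 := hl.le.trans (Nat.le_succ n)
    let x : splitField Ω t (n + 1) := ⟨lab s l, lab_mem_splitField hs hl'⟩
    rw [← ha l hl' x rfl, hfix x]
    have h1 := iterate_lab s l
    rw [hl] at h1
    exact h1.trans hs
  · rintro rfl
    exact hne (ha.gal_unique hs actsBy_one)
  · have hpow : ∀ k : ℕ, ActsBy s (σ ^ k) (a ^ k) := by
      intro k
      induction k with
      | zero => exact actsBy_one
      | succ k ih =>
        rw [pow_succ, pow_succ]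
        exact ih.mul ha
    have h1 := hpow p
    rw [hp] at h1
    exact h1.unique hs actsBy_one

end Action

/-! ### The Galois groups over `k(t)` and the comparison of monodromy groups -/

section RationalFunctions

variable {Ω : Type*} [Field Ω] [CharZero Ω] [IsAlgClosed Ω] {t : Ω}

/-- Uniform in the field of constants `k`: the discriminant relations have rational coefficients,
and the inertia elements fix all constants. -/
theorem galIsoE_base {k : Type*} [Field k] [Algebra k Ω] (ht : Transcendental k t) (n : ℕ) :
    GalIsoE (splitField Ω (base k t) n) (base k t) n := by
  have h0 : t ≠ 0 := by
    rintro rfl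
    exact ht isAlgebraic_zero
  have h1 : t ≠ 1 := by
    rintro rfl
    exact ht isAlgebraic_one
  obtain ⟨s, hs⟩ := exists_node h0 h1
  have hs' : s.y = algebraMap k⟮t⟯ Ω (base k t) := hs
  refine galIsoE_of_galImage_eq hs' (eq_E_of_exists_pow_eq_one (galImage (base k t) s hs')
    (fun n a => ?_) (galImage_le_map_res hs')
    (fun n => exists_mem_galImage_pow_eq_one hs' (exists_gal_sq_eq_one ht n))
    (fun n => exists_mem_galImage_pow_eq_one hs' (exists_gal_cube_eq_one ht n)) n)
  rintro ⟨σ, hσ⟩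
  obtain ⟨b, hbE, hb⟩ := exists_actsBy hs' σ
  rwa [hσ.unique hs' hb]

theorem natCard_gal {k : Type*} [Field k] [Algebra k Ω] (ht : Transcendental k t) (n : ℕ) :
    Nat.card Gal(splitField Ω (base k t) n/k⟮t⟯) = Nat.card (E n) := by
  obtain ⟨-, φ, -⟩ := galIsoE_base ht n
  exact Nat.card_congr φ.toEquiv

omit [IsAlgClosed Ω] in
theorem transcendental_of_isAlgebraic {k : Type*} [Field k] [Algebra ℚ k] [Algebra k Ω]
    [IsScalarTower ℚ k Ω] [Algebra.IsAlgebraic ℚ k] (ht : Transcendental ℚ t) : Transcendental k t :=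
  fun h => ht (h.restrictScalars ℚ)

omit [IsAlgClosed Ω] in
theorem transcendental_algebraicClosure (ht : Transcendental ℚ t) :
    Transcendental (algebraicClosure ℚ Ω) t := by
  let _ : Algebra ℚ (algebraicClosure ℚ Ω) := (algebraicClosure ℚ Ω).algebra'
  have : Algebra.IsAlgebraic ℚ (algebraicClosure ℚ Ω) := algebraicClosure.isAlgebraic ℚ Ω
  exact transcendental_of_isAlgebraic ht

omit [CharZero Ω] [IsAlgClosed Ω] in
theorem exists_restrict_of_le {k₁ k₂ : Type*} [Field k₁] [Field k₂] [Algebra k₁ Ω] [Algebra k₂ Ω]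
    {K₁ : IntermediateField k₁ Ω} {K₂ : IntermediateField k₂ Ω}
    (S : IntermediateField K₁ Ω) (T : IntermediateField K₂ Ω) [Normal K₁ S]
    (hK : ∀ x ∈ K₁, x ∈ K₂) (hST : ∀ x ∈ S, x ∈ T) (σ : Gal(T/K₂)) :
    ∃ τ : Gal(S/K₁), ∀ x : S,
      (⟨(τ x).1, hST (τ x).1 (τ x).2⟩ : T) = σ ⟨x.1, hST x.1 x.2⟩ := by
  let j : S →+* T := (algebraMap S Ω).codRestrict T fun x => hST x.1 x.2
  exact exists_restrict_of_embedding (K := K₁) j (σ : T →+* T) fun y =>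
    σ.commutes ⟨y.1, hK y.1 y.2⟩

theorem exists_restrict_geom (n : ℕ)
    (σ : Gal(splitField Ω (base (algebraicClosure ℚ Ω) t) n/(algebraicClosure ℚ Ω)⟮t⟯)) :
    ∃ τ : Gal(splitField Ω (base ℚ t) n/ℚ⟮t⟯), ∀ x, arithToGeom (τ x) = σ (arithToGeom x) := by
  have hle : ℚ⟮t⟯ ≤ ((algebraicClosure ℚ Ω)⟮t⟯).restrictScalars ℚ := by
    rw [adjoin_le_iff, Set.singleton_subset_iff]
    exact mem_adjoin_simple_self _ t
  exact exists_restrict_of_le (splitField Ω (base ℚ t) n)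
    (splitField Ω (base (algebraicClosure ℚ Ω) t) n) (fun _ hx => hle hx)
    (fun _ hx => mem_geom_of_mem_arith hx) σ

omit [IsAlgClosed Ω] in
theorem arithToGeom_injective {n : ℕ} :
    Function.Injective (arithToGeom (Ω := Ω) (t := t) (n := n)) :=
  fun _ _ h => Subtype.ext (Subtype.mk.inj h)

/-- Restriction is injective because the same preimages of `t` generate both splitting fields, and
it is bijective because both groups have the order of `E n`. -/
theorem exists_restrictEquiv (ht : Transcendental ℚ t) (n : ℕ) :
    ∃ R : Gal(splitField Ω (base (algebraicClosure ℚ Ω) t) n/(algebraicClosure ℚ Ω)⟮t⟯) ≃*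
      Gal(splitField Ω (base ℚ t) n/ℚ⟮t⟯),
      ∀ σ x, arithToGeom (R σ x) = σ (arithToGeom x) := by
  choose r hr using fun σ => exists_restrict_geom (t := t) n σ
  let R : Gal(splitField Ω (base (algebraicClosure ℚ Ω) t) n/(algebraicClosure ℚ Ω)⟮t⟯) →*
      Gal(splitField Ω (base ℚ t) n/ℚ⟮t⟯) := MonoidHom.mk' r fun σ τ => by
    ext1 x
    apply arithToGeom_injective
    rw [hr, AlgEquiv.mul_apply, AlgEquiv.mul_apply, hr, hr]
  have hinj : Function.Injective R := by
    intro σ τ hστ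
    have hστ' : r σ = r τ := hστ
    refine gal_ext fun x hx => ?_
    obtain ⟨y, rfl⟩ : ∃ y, arithToGeom y = x :=
      ⟨⟨x.1, mem_splitField_of_iterate le_rfl hx⟩, rfl⟩
    rw [← hr, ← hr, hστ']
  have hcard := (natCard_gal (transcendental_algebraicClosure ht) n).trans
    (natCard_gal ht n).symm
  exact ⟨MulEquiv.ofBijective R (hinj.bijective_of_nat_card_le hcard.ge), hr⟩

theorem exists_monodromyEquiv (ht : Transcendental ℚ t) :
    ∃ Φ : geomMonodromy t ≃ₜ* arithMonodromy t,
      ∀ (σ : geomMonodromy t) (n : ℕ) (x : splitField Ω (base ℚ t) n),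
        arithToGeom ((Φ σ).1 n x) = σ.1 n (arithToGeom x) := by
  choose R hR using exists_restrictEquiv ht
  have hto : ∀ σ ∈ monodromy (Ω := Ω) (base (algebraicClosure ℚ Ω) t),
      (fun n => R n (σ n)) ∈ monodromy (Ω := Ω) (base ℚ t) := by
    intro σ hσ m n h x
    apply arithToGeom_injective
    rw [hR]
    refine (hσ m n h (arithToGeom x)).trans ?_
    rw [← hR]
    rfl
  have hinv : ∀ τ ∈ monodromy (Ω := Ω) (base ℚ t),
      (fun n => (R n).symm (τ n)) ∈ monodromy (Ω := Ω) (base (algebraicClosure ℚ Ω) t) := by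
    intro τ hτ m n h x
    have hRn : ∀ n x, (R n).symm (τ n) (arithToGeom x) = arithToGeom (τ n x) := by
      intro n x
      rw [← hR, MulEquiv.apply_symm_apply]
    let i := inclusion (splitField_mono (Ω := Ω) (base (algebraicClosure ℚ Ω) t) h)
    -- Compatibility of the inverses: the restriction `σ` of `(R n)⁻¹ (τ n)` to the geometric field
    -- of level `m` has the same image under `R m` as `(R m)⁻¹ (τ m)`, so the two coincide.
    obtain ⟨σ, hσ⟩ := exists_restrict_of_embedding i.toRingHom
      ((R n).symm (τ n) : splitField Ω (base (algebraicClosure ℚ Ω) t) n →+* _)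
      fun y => ((R n).symm (τ n)).commutes y
    have hσ' : ∀ x, i (σ x) = (R n).symm (τ n) (i x) := hσ
    have heq : σ = (R m).symm (τ m) := by
      rw [MulEquiv.eq_symm_apply]
      ext1 y
      apply arithToGeom_injective
      apply i.injective
      rw [hR]
      refine (hσ' _).trans ?_
      refine (hRn n (inclusion (splitField_mono (base ℚ t) h) y)).trans ?_
      rw [hτ m n h y]
      rfl
    have hx := hσ' x
    rw [heq] at hx
    exact hx.symm
  let Φ : geomMonodromy t ≃* arithMonodromy t :=
    { toFun := fun σ => ⟨fun n => R n (σ.1 n), hto σ.1 σ.2⟩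
      invFun := fun τ => ⟨fun n => (R n).symm (τ.1 n), hinv τ.1 τ.2⟩
      left_inv := fun σ => Subtype.ext (funext fun n => (R n).symm_apply_apply _)
      right_inv := fun τ => Subtype.ext (funext fun n => (R n).apply_symm_apply _)
      map_mul' := fun σ τ => Subtype.ext (funext fun n => map_mul (R n) _ _) }
  -- Each finite level is discrete, so both directions are continuous coordinate by coordinate.
  refine ⟨{ Φ with continuous_toFun := ?_, continuous_invFun := ?_ }, fun σ n x => hR n _ x⟩
  · exact Continuous.subtype_mk (continuous_pi fun n =>
      (continuous_of_discreteTopology (f := R n)).comp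
        ((continuous_apply n).comp continuous_subtype_val)) _
  · exact Continuous.subtype_mk (continuous_pi fun n =>
      (continuous_of_discreteTopology (f := (R n).symm)).comp
        ((continuous_apply n).comp continuous_subtype_val)) _

end RationalFunctions

end Arboreal

end

open Arboreal IntermediateField
theorem corollary1p3 {Ω : Type*} [Field Ω] [CharZero Ω] [IsAlgClosed Ω]
    (t : Ω) (ht : Transcendental ℚ t) :
    -- the geometric case: `Gal(fⁿ(z) - t / ℚ̄(t)) ≅ E_n`
    (∀ n : ℕ, 1 ≤ n →
      GalIsoE (splitField Ω (base (algebraicClosure ℚ Ω) t) n)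
        (base (algebraicClosure ℚ Ω) t) n) ∧
    -- the same group over `L(t)` for every number field `L`
    (∀ (L : Type*) [Field L] [NumberField L] [Algebra L Ω], ∀ n : ℕ, 1 ≤ n →
      GalIsoE (splitField Ω (base L t) n) (base L t) n) ∧
    -- restriction is an isomorphism from the geometric to the arithmetic monodromy group
    (∃ Φ : geomMonodromy t ≃ₜ* arithMonodromy t,
      ∀ (σ : geomMonodromy t) (n : ℕ) (x : splitField Ω (base ℚ t) n),
        arithToGeom ((Φ σ).1 n x) = σ.1 n (arithToGeom x)) := by
  refine ⟨fun n _ => galIsoE_base (transcendental_algebraicClosure ht) n, ?_,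
    exists_monodromyEquiv ht⟩
  intro L _ _ _ n _
  exact galIsoE_base (transcendental_of_isAlgebraic ht) n
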